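/- For positive integers $m,n$, let $K_{m,n}$ be the metric complete bipartite graph (with $m$ and $n$ vertices in its two parts) in which every edge is a segment of length $1$; its genus is $(m-1)(n-1)$. A divisor on $K_{m,n}$ is a finite formal integer combination of points of $K_{m,n}$ (vertices or points in the interior of edges), and its degree is the sum of its coefficients. A rational function is a continuous function $f:K_{m,n}\to\mathbb{R}$ that is piecewise linear (with finitely many pieces) with integer slopes on each edge; its divisor is $\sum_p \mathrm{ord}_p(f)\,p$, where $\mathrm{ord}_p(f)$ is the sum of the outgoing slopes of $f$ at $p$. Two divisors are linearly equivalent if their difference is the divisor of a rational function. The rank $\mathrm{rk}(D)$ of a divisor $D$ is the largest integer $k\ge -1$ such that, for every effective divisor $E$ of degree $k$, the divisor $D-E$ is linearly equivalent to an effective divisor (so $\mathrm{rk}(D)=-1$ if $D$ itself is not linearly equivalent to an effective divisor). Put $$d_r(K_{m,n})=\min\{d\in\mathbb{Z} \mid \text{there is a divisor } D \text{ on } K_{m,n} \text{ with } \deg(D)=d \text{ and } \mathrm{rk}(D)\ge r\}.$$ For an integer $r$ with $0<r<(m-1)(n-1)$, let $I_r$ be the set of triples $(a,b,h)\in\mathbb{Z}^3$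 with $$0\le a\le m-1,\qquad 0\le b\le n-1,\qquad h\ge 0,\qquad r=(a+1)(b+1)-1-h,$$ and let $\delta_r(m,n)=\min\{an+bm-h \mid (a,b,h)\in I_r\}$. **Theorem.** For all positive integers $m,n$ and all integers $r$ with $0<r<(m-1)(n-1)$, both minima exist and $$d_r(K_{m,n})=\delta_r(m,n).$$ -/

import Mathlib

/-- A finite metric graph with vertices `V` and edges `E`: every edge `e` is a segment
`[0, len e]` of positive length whose ends `0` and `len e` are glued to the vertices
`src e` and `tgt e`.  (The direction of an edge only serves to parametrize it.) -/
structure MetricGraph (V E : Type*) where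
  src : E → V
  tgt : E → V
  len : E → ℝ
  len_pos : ∀ e, 0 < len e

namespace MetricGraph

/-- The points of the metric graph: its vertices, and the points in the interior of an edge. -/
inductive Point {V E : Type*} (Γ : MetricGraph V E) where
  | vertex (v : V) : Point Γ
  | interior (e : E) (t : Set.Ioo (0 : ℝ) (Γ.len e)) : Point Γ

open scoped Classical in
/-- The parametrization `[0, len e] → Γ` of the edge `e`
(extended to all of `ℝ` by the end points). -/
noncomputable def edgePoint {V E : Type*} (Γ : MetricGraph V E) (e : E) (t : ℝ) : Γ.Point :=
  if h : t ∈ Set.Ioo (0 : ℝ) (Γ.len e) then Point.interior e ⟨t, h⟩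
  else if t ≤ 0 then Point.vertex (Γ.src e) else Point.vertex (Γ.tgt e)

/-- `g` is (continuous and) piecewise linear with integer slopes on `[0, L]`: there is a finite set
of breakpoints such that `g` is affine with integer slope on every closed subinterval that has
no breakpoint in its interior. -/
def IsIntegerPL (L : ℝ) (g : ℝ → ℝ) : Prop :=
  ∃ S : Finset ℝ, ∀ s t : ℝ, 0 ≤ s → s < t → t ≤ L → (∀ x ∈ S, x ∉ Set.Ioo s t) →
    ∃ k : ℤ, ∀ x ∈ Set.Icc s t, g x = g s + (k : ℝ) * (x - s)

/-- A rational function on `Γ`: a continuous function that is piecewise linear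
with integer slopes on every edge. -/
def IsRational {V E : Type*} (Γ : MetricGraph V E) (f : Γ.Point → ℝ) : Prop :=
  ∀ e, IsIntegerPL (Γ.len e) (fun t => f (Γ.edgePoint e t))

/-- The slope of `f` on the edge `e` at the parameter `t`, in the direction of increasing
parameter. -/
noncomputable def slopeForward {V E : Type*} (Γ : MetricGraph V E) (f : Γ.Point → ℝ)
    (e : E) (t : ℝ) : ℝ :=
  derivWithin (fun s => f (Γ.edgePoint e s)) (Set.Ioi t) t

/-- The slope of `f` on the edge `e` at the parameter `t`, in the direction of decreasing
parameter. -/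
noncomputable def slopeBackward {V E : Type*} (Γ : MetricGraph V E) (f : Γ.Point → ℝ)
    (e : E) (t : ℝ) : ℝ :=
  -derivWithin (fun s => f (Γ.edgePoint e s)) (Set.Iio t) t

/-- The order of `f` at a point: the sum of the outgoing slopes of `f` at that point,
over all tangent directions. -/
noncomputable def ord {V E : Type*} [DecidableEq V] [Fintype E] (Γ : MetricGraph V E)
    (f : Γ.Point → ℝ) : Γ.Point → ℝ
  | Point.vertex v =>
      (∑ e ∈ Finset.univ.filter (fun e => Γ.src e = v), Γ.slopeForward f e 0) +
      ∑ e ∈ Finset.univ.filter (fun e => Γ.tgt e = v), Γ.slopeBackward f e (Γ.len e)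
  | Point.interior e t => Γ.slopeForward f e t + Γ.slopeBackward f e t

/-- The group of divisors on `Γ`: finite formal integer combinations of points. -/
abbrev Divisor {V E : Type*} (Γ : MetricGraph V E) : Type _ := Γ.Point →₀ ℤ

/-- The degree of a divisor. -/
def deg {V E : Type*} (Γ : MetricGraph V E) (D : Γ.Divisor) : ℤ := D.sum fun _ z => z

/-- Linear equivalence: the difference is the divisor of a rational function. -/
def LinEquiv {V E : Type*} [DecidableEq V] [Fintype E] (Γ : MetricGraph V E)
    (D D' : Γ.Divisor) : Prop :=
  ∃ f : Γ.Point → ℝ, Γ.IsRational f ∧ ∀ p, ((D p - D' p : ℤ) : ℝ) = Γ.ord f p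

/-- The complete linear system `|D|`: effective divisors linearly equivalent to `D`. -/
def linearSystem {V E : Type*} [DecidableEq V] [Fintype E] (Γ : MetricGraph V E)
    (D : Γ.Divisor) : Set Γ.Divisor :=
  {D' | 0 ≤ D' ∧ Γ.LinEquiv D D'}

/-- The rank of a divisor: the largest integer `k ≥ -1` such that `|D - E| ≠ ∅` for all effective
divisors `E` of degree `k`.  (For `k = -1` there is no such `E`, so that the rank is `-1` exactly
when `|D| = ∅`.) -/
noncomputable def rank {V E : Type*} [DecidableEq V] [Fintype E] (Γ : MetricGraph V E)
    (D : Γ.Divisor) : ℤ :=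
  sSup {k : ℤ | -1 ≤ k ∧
    ∀ F : Γ.Divisor, 0 ≤ F → Γ.deg F = k → (Γ.linearSystem (D - F)).Nonempty}

/-- The degrees of the divisors of rank at least `r`. -/
def gonalityDegrees {V E : Type*} [DecidableEq V] [Fintype E] (Γ : MetricGraph V E)
    (r : ℤ) : Set ℤ :=
  {d | ∃ D : Γ.Divisor, Γ.deg D = d ∧ r ≤ Γ.rank D}

/-- The entry `d_r(Γ)` of the gonality sequence. -/
noncomputable def gonality {V E : Type*} [DecidableEq V] [Fintype E] (Γ : MetricGraph V E)
    (r : ℤ) : ℤ :=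
  sInf (Γ.gonalityDegrees r)

/-- The genus (first Betti number) of a connected metric graph. -/
def genus {V E : Type*} [Fintype V] [Fintype E] (_Γ : MetricGraph V E) : ℤ :=
  (Fintype.card E : ℤ) - (Fintype.card V : ℤ) + 1

/-- The metric complete bipartite graph `K_{m,n}` with all edge lengths equal to one. -/
def completeBipartite (m n : ℕ) : MetricGraph (Fin m ⊕ Fin n) (Fin m × Fin n) where
  src e := Sum.inl e.1
  tgt e := Sum.inr e.2
  len _ := 1
  len_pos _ := one_pos

end MetricGraph

/-- The set `I_r` of triples `(a, b, h)`. -/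
def tripleSet (m n r : ℤ) : Set (ℤ × ℤ × ℤ) :=
  {x | 0 ≤ x.1 ∧ x.1 ≤ m - 1 ∧ 0 ≤ x.2.1 ∧ x.2.1 ≤ n - 1 ∧ 0 ≤ x.2.2 ∧
    r = (x.1 + 1) * (x.2.1 + 1) - 1 - x.2.2}

/-- The values `a n + b m - h` for `(a, b, h)` in `I_r`. -/
def deltaValues (m n r : ℤ) : Set ℤ :=
  (fun x : ℤ × ℤ × ℤ => x.1 * n + x.2.1 * m - x.2.2) '' tripleSet m n r

/-- `δ_r(m, n)`, the minimum of these values. -/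
noncomputable def delta (m n r : ℤ) : ℤ := sInf (deltaValues m n r)

/-! Real potentials `α`, `β` at the two vertex classes replace a divisor by an equivalent one with
at most one chip inside every edge (`exists_linEquiv_of_potential`). Its coefficient at a vertex is
`excess - 1`, a sum of ceilings `⌈σ i j + α i - β j⌉`, where `σ` records the total positions of the
chips on the edges. If the potentials lie in distinct cosets of a subgroup `K` containing `1` and
all `σ i j`, every edge carries exactly one interior chip. Let `P` and `N` be the total positive and
negative excess of such a generic configuration. Then `P - N = deg + m + n - m n`
(`Generic.sum_excess`), and the rank is less than `P`: removing `P` suitable chips makes all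
vertices negative, and a minimum principle (`linearSystem_eq_empty`) excludes an effective
representative.

Lower bound for the degree. Balance first one side and then the other, starting from a generic
configuration with minimal `P`. Minimality forbids cancellation in the matrix of chip movements, so
its positive and negative parts occupy complementary blocks: unless `P` or `N` vanishes, `P ≤ w h`
and `N ≤ (m - w)(n - h)` (`rectangle_bounds`, `exists_posExcess_le_rectangle`). With `r < P`, the
formula for `P - N` bounds the degree by the value of the triple `(w - 1, h - 1, w h - 1 - r)`.

Upper bound. Put `b` chips on each vertex of the part of size `m` and `a` on each of the other part.
If removing an effective `F` left a class without effective divisors, a burning argument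
(`exists_effective_or_generic_nonpos`) would give a generic configuration without positive excess.
Putting `F` back creates positive excess at most `deg F`, whereas the constant divisor always has at
least `(a + 1)(b + 1)` (`mul_le_posExcess_const`). Removing `h` further chips gives the required
divisors. -/

/-! ### Piecewise linear functions with integer slopes -/

namespace MetricGraph

namespace IsIntegerPL

variable {L : ℝ} {g h : ℝ → ℝ}

lemma exists_affine_right (hg : IsIntegerPL L g) {t : ℝ} (h0 : 0 ≤ t) (hL : t < L) :
    ∃ s, t < s ∧ s ≤ L ∧ ∃ k : ℤ, ∀ x ∈ Set.Icc t s, g x = g t + k * (x - t) := by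
  obtain ⟨S, hS⟩ := hg
  have hev : ∀ᶠ s in nhdsWithin t (Set.Ioi t), ∀ x ∈ S, x ∉ Set.Ioo t s := by
    rw [Filter.eventually_all_finset]
    intro x _
    by_cases hx : t < x
    · filter_upwards [Ioo_mem_nhdsGT hx] with s hs hxs
      exact absurd hxs.2 (not_lt.2 hs.2.le)
    · exact Filter.Eventually.of_forall fun s hxs => hx hxs.1
  obtain ⟨s, hs, hs1, hs2⟩ := (hev.and (Ioc_mem_nhdsGT hL)).exists
  exact ⟨s, hs1, hs2, hS t s h0 hs1 hs2 hs⟩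

lemma exists_affine_left (hg : IsIntegerPL L g) {t : ℝ} (h0 : 0 < t) (hL : t ≤ L) :
    ∃ s, s < t ∧ 0 ≤ s ∧ ∃ k : ℤ, ∀ x ∈ Set.Icc s t, g x = g t + k * (x - t) := by
  obtain ⟨S, hS⟩ := hg
  have hev : ∀ᶠ s in nhdsWithin t (Set.Iio t), ∀ x ∈ S, x ∉ Set.Ioo s t := by
    rw [Filter.eventually_all_finset]
    intro x _
    by_cases hx : x < t
    · filter_upwards [Ioo_mem_nhdsLT hx] with s hs hxs
      exact absurd hxs.1 (not_lt.2 hs.1.le)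
    · exact Filter.Eventually.of_forall fun s hxs => hx hxs.2
  obtain ⟨s, hs, hs1, hs2⟩ := (hev.and (Ico_mem_nhdsLT h0)).exists
  obtain ⟨k, hk⟩ := hS s t hs1 hs2 hL hs
  refine ⟨s, hs2, hs1, k, fun x hx => ?_⟩
  rw [hk x hx, hk t ⟨hs2.le, le_rfl⟩]
  ring

lemma _root_.MetricGraph.hasDerivWithinAt_of_affine_right {s t k : ℝ} (hs : t < s)
    (hk : ∀ x ∈ Set.Icc t s, g x = g t + k * (x - t)) :
    HasDerivWithinAt g k (Set.Ioi t) t := by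
  have h1 : HasDerivWithinAt (fun x => g t + k * (x - t)) k (Set.Ioi t) t := by
    simpa using ((((hasDerivAt_id t).sub_const t).const_mul k).const_add (g t)).hasDerivWithinAt
  refine h1.congr_of_eventuallyEq ?_ (by simp)
  filter_upwards [Ioo_mem_nhdsGT hs] with x hx using hk x ⟨hx.1.le, hx.2.le⟩

lemma _root_.MetricGraph.hasDerivWithinAt_of_affine_left {s t k : ℝ} (hs : s < t)
    (hk : ∀ x ∈ Set.Icc s t, g x = g t + k * (x - t)) :
    HasDerivWithinAt g k (Set.Iio t) t := by
  have h1 : HasDerivWithinAt (fun x => g t + k * (x - t)) k (Set.Iio t) t := by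
    simpa using ((((hasDerivAt_id t).sub_const t).const_mul k).const_add (g t)).hasDerivWithinAt
  refine h1.congr_of_eventuallyEq ?_ (by simp)
  filter_upwards [Ioo_mem_nhdsLT hs] with x hx using hk x ⟨hx.1.le, hx.2.le⟩

lemma exists_hasDerivWithinAt_Ioi (hg : IsIntegerPL L g) {t : ℝ} (h0 : 0 ≤ t) (hL : t < L) :
    ∃ k : ℤ, HasDerivWithinAt g k (Set.Ioi t) t := by
  obtain ⟨s, hs, -, k, hk⟩ := hg.exists_affine_right h0 hL
  exact ⟨k, hasDerivWithinAt_of_affine_right hs hk⟩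

lemma exists_hasDerivWithinAt_Iio (hg : IsIntegerPL L g) {t : ℝ} (h0 : 0 < t) (hL : t ≤ L) :
    ∃ k : ℤ, HasDerivWithinAt g k (Set.Iio t) t := by
  obtain ⟨s, hs, -, k, hk⟩ := hg.exists_affine_left h0 hL
  exact ⟨k, hasDerivWithinAt_of_affine_left hs hk⟩

lemma affine (c : ℝ) (k : ℤ) : IsIntegerPL L (fun t => c + k * t) :=
  ⟨∅, fun s _ _ _ _ _ => ⟨k, fun x _ => by ring⟩⟩

lemma add (hg : IsIntegerPL L g) (hh : IsIntegerPL L h) : IsIntegerPL L (fun t => g t + h t) := by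
  classical
  obtain ⟨S, hS⟩ := hg
  obtain ⟨T, hT⟩ := hh
  refine ⟨S ∪ T, fun s t h0 hst hL hx => ?_⟩
  obtain ⟨k, hk⟩ := hS s t h0 hst hL fun x hxS => hx x (Finset.mem_union_left _ hxS)
  obtain ⟨l, hl⟩ := hT s t h0 hst hL fun x hxT => hx x (Finset.mem_union_right _ hxT)
  refine ⟨k + l, fun x hx => ?_⟩
  simp only [hk x hx, hl x hx]
  push_cast
  ring

lemma int_mul (hg : IsIntegerPL L g) (z : ℤ) : IsIntegerPL L (fun t => z * g t) := by
  obtain ⟨S, hS⟩ := hg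
  refine ⟨S, fun s t h0 hst hL hx => ?_⟩
  obtain ⟨k, hk⟩ := hS s t h0 hst hL hx
  refine ⟨z * k, fun x hx => ?_⟩
  simp only [hk x hx]
  push_cast
  ring

lemma sub (hg : IsIntegerPL L g) (hh : IsIntegerPL L h) : IsIntegerPL L (fun t => g t - h t) := by
  simpa [sub_eq_add_neg] using hg.add (hh.int_mul (-1))

lemma sum {ι : Type*} (s : Finset ι) {g : ι → ℝ → ℝ} (hg : ∀ i ∈ s, IsIntegerPL L (g i)) :
    IsIntegerPL L (fun t => ∑ i ∈ s, g i t) := by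
  classical
  induction s using Finset.induction_on with
  | empty => simpa using affine (L := L) 0 0
  | insert i s his ih =>
    simp only [Finset.sum_insert his]
    exact (hg i (by simp)).add (ih fun j hj => hg j (by simp [hj]))

lemma hinge (p : ℝ) : IsIntegerPL L (fun t => max (t - p) 0) := by
  refine ⟨{p}, fun s t _ hst _ hp => ?_⟩
  simp only [Finset.mem_singleton, forall_eq, Set.mem_Ioo, not_and, not_lt] at hp
  rcases le_or_gt p s with h | h
  · refine ⟨1, fun x hx => ?_⟩
    dsimp only
    rw [max_eq_left (by linarith [hx.1]), max_eq_left (by linarith)]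
    push_cast
    ring
  · have ht := hp h
    refine ⟨0, fun x hx => ?_⟩
    dsimp only
    rw [max_eq_right (by linarith [hx.2]), max_eq_right (by linarith)]
    simp

lemma congr (hg : IsIntegerPL L g) (hgh : ∀ t ∈ Set.Icc 0 L, h t = g t) : IsIntegerPL L h := by
  obtain ⟨S, hS⟩ := hg
  refine ⟨S, fun s t h0 hst hL hx => ?_⟩
  obtain ⟨k, hk⟩ := hS s t h0 hst hL hx
  refine ⟨k, fun x hx => ?_⟩
  rw [hgh x ⟨h0.trans hx.1, hx.2.trans hL⟩, hgh s ⟨h0, hst.le.trans hL⟩, hk x hx]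

/-- A piecewise linear function whose slope never increases lies between its end tangents. -/
lemma tangent_bounds (hg : IsIntegerPL L g) {s t : ℝ} (h0 : 0 ≤ s) (hst : s < t) (hL : t ≤ L)
    (hc : ∀ x ∈ Set.Ioo s t,
      derivWithin g (Set.Ioi x) x ≤ derivWithin g (Set.Iio x) x) :
    g t - g s ≤ derivWithin g (Set.Ioi s) s * (t - s) ∧
    derivWithin g (Set.Iio t) t * (t - s) ≤ g t - g s ∧
    derivWithin g (Set.Iio t) t ≤ derivWithin g (Set.Ioi s) s := by
  classical
  obtain ⟨S, hS⟩ := hg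
  -- Induction on the number of breakpoints inside `(s, t)`: `g` is affine up to the first one, and
  -- `hc` compares the slopes there.
  induction hn : (S.filter (fun x => x ∈ Set.Ioo s t)).card using Nat.strong_induction_on
    generalizing s with
  | _ n ih =>
  have key : ∀ x, s < x → x ≤ t → (∀ y ∈ S, y ∉ Set.Ioo s x) → ∃ k : ℤ,
      derivWithin g (Set.Ioi s) s = k ∧ derivWithin g (Set.Iio x) x = k ∧
      g x - g s = k * (x - s) := by
    intro x hsx hxt hy
    obtain ⟨k, hk⟩ := hS s x h0 hsx (hxt.trans hL) hy
    have hx := hk x ⟨hsx.le, le_rfl⟩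
    refine ⟨k, (hasDerivWithinAt_of_affine_right hsx hk).derivWithin (uniqueDiffWithinAt_Ioi s),
      (hasDerivWithinAt_of_affine_left hsx fun y hy => ?_).derivWithin
        (uniqueDiffWithinAt_Iio x), by rw [hx]; ring⟩
    rw [hk y hy, hx]
    ring
  rcases (S.filter (fun x => x ∈ Set.Ioo s t)).eq_empty_or_nonempty with he | hne
  · obtain ⟨k, h1, h2, h3⟩ := key t hst le_rfl fun y hy hyst =>
      Finset.notMem_empty y (he ▸ Finset.mem_filter.2 ⟨hy, hyst⟩)
    rw [h1, h2, h3]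
    exact ⟨le_rfl, le_rfl, le_rfl⟩
  · set x := (S.filter (fun x => x ∈ Set.Ioo s t)).min' hne with hxdef
    have hxmem := Finset.min'_mem _ hne
    rw [← hxdef, Finset.mem_filter] at hxmem
    obtain ⟨hxS, hsx, hxt⟩ := hxmem
    obtain ⟨k, h1, h2, h3⟩ := key x hsx hxt.le fun y hy hyst => by
      exact absurd hyst.2 (not_lt.2 (hxdef ▸ Finset.min'_le _ y
        (Finset.mem_filter.2 ⟨hy, hyst.1, hyst.2.trans hxt⟩)))
    have hcx := hc x ⟨hsx, hxt⟩
    rw [h2] at hcx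
    have hlt : (S.filter (fun y => y ∈ Set.Ioo x t)).card < n := by
      rw [← hn]
      refine Finset.card_lt_card ⟨fun y hy => ?_, fun hsub => ?_⟩
      · rw [Finset.mem_filter] at hy ⊢
        exact ⟨hy.1, hsx.trans hy.2.1, hy.2.2⟩
      · have := hsub (Finset.mem_filter.2 ⟨hxS, hsx, hxt⟩)
        rw [Finset.mem_filter] at this
        exact absurd this.2.1 (lt_irrefl x)
    obtain ⟨i1, i2, i3⟩ := ih _ hlt (h0.trans hsx.le) hxt
      (fun y hy => hc y ⟨hsx.trans hy.1, hy.2⟩) rfl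
    rw [h1]
    have hl : derivWithin g (Set.Iio t) t ≤ k := i3.trans hcx
    refine ⟨?_, ?_, hl⟩
    · nlinarith
    · nlinarith

end IsIntegerPL

/-! ### Rational functions and their divisors -/

section Ord

variable {V E : Type*} {Γ : MetricGraph V E}

lemma edgePoint_zero (e : E) : Γ.edgePoint e 0 = Point.vertex (Γ.src e) := by
  simp [edgePoint]

lemma edgePoint_len (e : E) : Γ.edgePoint e (Γ.len e) = Point.vertex (Γ.tgt e) := by
  simp [edgePoint, not_le.2 (Γ.len_pos e)]

lemma edgePoint_of_mem (e : E) {t : ℝ} (ht : t ∈ Set.Ioo 0 (Γ.len e)) :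
    Γ.edgePoint e t = Point.interior e ⟨t, ht⟩ := by
  simp only [edgePoint, ht, dite_true]

lemma IsRational.sub {f g : Γ.Point → ℝ} (hf : Γ.IsRational f) (hg : Γ.IsRational g) :
    Γ.IsRational (f - g) :=
  fun e => (hf e).sub (hg e)

lemma IsRational.slopeForward_sub {f g : Γ.Point → ℝ} (hf : Γ.IsRational f)
    (hg : Γ.IsRational g) {e : E} {t : ℝ} (h0 : 0 ≤ t) (hL : t < Γ.len e) :
    Γ.slopeForward (f - g) e t = Γ.slopeForward f e t - Γ.slopeForward g e t := by
  obtain ⟨k, hk⟩ := (hf e).exists_hasDerivWithinAt_Ioi h0 hL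
  obtain ⟨l, hl⟩ := (hg e).exists_hasDerivWithinAt_Ioi h0 hL
  have hu := uniqueDiffWithinAt_Ioi t
  unfold slopeForward
  rw [hk.derivWithin hu, hl.derivWithin hu]
  exact (hk.sub hl).derivWithin hu

lemma IsRational.slopeBackward_sub {f g : Γ.Point → ℝ} (hf : Γ.IsRational f)
    (hg : Γ.IsRational g) {e : E} {t : ℝ} (h0 : 0 < t) (hL : t ≤ Γ.len e) :
    Γ.slopeBackward (f - g) e t = Γ.slopeBackward f e t - Γ.slopeBackward g e t := by
  obtain ⟨k, hk⟩ := (hf e).exists_hasDerivWithinAt_Iio h0 hL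
  obtain ⟨l, hl⟩ := (hg e).exists_hasDerivWithinAt_Iio h0 hL
  have hu := uniqueDiffWithinAt_Iio t
  unfold slopeBackward
  rw [hk.derivWithin hu, hl.derivWithin hu, (show derivWithin
    (fun s => (f - g) (Γ.edgePoint e s)) (Set.Iio t) t = k - l from (hk.sub hl).derivWithin hu)]
  ring

variable [DecidableEq V] [Fintype E]

lemma IsRational.ord_sub {f g : Γ.Point → ℝ} (hf : Γ.IsRational f)
    (hg : Γ.IsRational g) (p : Γ.Point) : Γ.ord (f - g) p = Γ.ord f p - Γ.ord g p := by
  cases p with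
  | vertex v =>
    simp only [ord, hf.slopeForward_sub hg le_rfl (Γ.len_pos _),
      hf.slopeBackward_sub hg (Γ.len_pos _) le_rfl, Finset.sum_sub_distrib]
    ring
  | interior e t =>
    simp only [ord, hf.slopeForward_sub hg t.2.1.le t.2.2,
      hf.slopeBackward_sub hg t.2.1 t.2.2.le]
    ring

/-- A complete linear system only depends on the divisor class. -/
lemma LinEquiv.linearSystem_sub_nonempty {D D' : Γ.Divisor} (h : Γ.LinEquiv D D') (F : Γ.Divisor)
    (hF : (Γ.linearSystem (D - F)).Nonempty) : (Γ.linearSystem (D' - F)).Nonempty := by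
  obtain ⟨g, hg, hgD⟩ := h
  obtain ⟨C, hC, f, hf, hfC⟩ := hF
  refine ⟨C, hC, f - g, hf.sub hg, fun p => ?_⟩
  rw [hf.ord_sub hg, ← hfC, ← hgD]
  simp only [Finsupp.sub_apply]
  push_cast
  ring

/-- A divisor that is negative at all vertices, with at most one chip inside each edge,
is not equivalent to an effective divisor. -/
lemma linearSystem_eq_empty [Fintype V] [Nonempty V] {D : Γ.Divisor}
    (hV : ∀ v, D (Point.vertex v) ≤ -1)
    (θ : ∀ e, Set.Ioo (0 : ℝ) (Γ.len e))
    (hθ : ∀ e, D (Point.interior e (θ e)) ≤ 1)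
    (hE : ∀ e t, t ≠ θ e → D (Point.interior e t) ≤ 0) :
    Γ.linearSystem D = ∅ := by
  rw [Set.eq_empty_iff_forall_notMem]
  rintro C ⟨hC, f, hf, hord⟩
  -- As `C` is effective, `D` bounds the order of `f`. On each edge the slope of `f` can therefore
  -- rise only at `θ e`, and there by at most `1`.
  have hle : ∀ p, Γ.ord f p ≤ D p := fun p => by
    rw [← hord p]
    exact_mod_cast (by have := hC p; simp at this; omega : D p - C p ≤ D p)
  obtain ⟨v, hv⟩ := Finite.exists_min (fun v => f (Point.vertex v))
  have hneg : Γ.ord f (Point.vertex v) < 0 :=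
    (hle _).trans_lt (by exact_mod_cast (hV v).trans_lt (by norm_num))
  have hint : ∀ e t, (ht : t ∈ Set.Ioo 0 (Γ.len e)) →
      derivWithin (fun s => f (Γ.edgePoint e s)) (Set.Ioi t) t -
        derivWithin (fun s => f (Γ.edgePoint e s)) (Set.Iio t) t ≤
        D (Point.interior e ⟨t, ht⟩) := fun e t ht => by
    have := hle (Point.interior e ⟨t, ht⟩)
    simpa only [ord, slopeForward, slopeBackward, ← sub_eq_add_neg] using this
  have hbounds : ∀ e, _ := fun e => (hf e).tangent_bounds le_rfl (θ e).2.1 (θ e).2.2.le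
    fun t ht => by
      have h1 := hint e t ⟨ht.1, ht.2.trans (θ e).2.2⟩
      have h2 := hE e ⟨t, ht.1, ht.2.trans (θ e).2.2⟩ fun h => ht.2.ne (congrArg Subtype.val h)
      have h3 : ((D (Point.interior e ⟨t, ht.1, ht.2.trans (θ e).2.2⟩) : ℤ) : ℝ) ≤ 0 := by
        exact_mod_cast h2
      linarith
  have hbounds' : ∀ e, _ := fun e => (hf e).tangent_bounds (θ e).2.1.le (θ e).2.2 le_rfl
    fun t ht => by
      have h1 := hint e t ⟨(θ e).2.1.trans ht.1, ht.2⟩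
      have h2 := hE e ⟨t, (θ e).2.1.trans ht.1, ht.2⟩ fun h => ht.1.ne' (congrArg Subtype.val h)
      have h3 : ((D (Point.interior e ⟨t, (θ e).2.1.trans ht.1, ht.2⟩) : ℤ) : ℝ) ≤ 0 := by
        exact_mod_cast h2
      linarith
  have hmid : ∀ e, derivWithin (fun s => f (Γ.edgePoint e s)) (Set.Ioi (θ e : ℝ)) (θ e) ≤
      derivWithin (fun s => f (Γ.edgePoint e s)) (Set.Iio (θ e : ℝ)) (θ e) + 1 := fun e => by
    have h1 := hint e _ (θ e).2
    have h3 : ((D (Point.interior e (θ e)) : ℤ) : ℝ) ≤ 1 := by exact_mod_cast hθ e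
    have h4 : (⟨(θ e : ℝ), (θ e).2⟩ : Set.Ioo (0 : ℝ) (Γ.len e)) = θ e := rfl
    rw [h4] at h1
    linarith
  simp only [edgePoint_zero, edgePoint_len] at hbounds hbounds'
  -- A negative outgoing slope at the minimum `v` is at most `-1` by integrality. After the single
  -- possible rise it is still at most `0`, so the far end would lie strictly below `v`.
  have hsrc : ∀ e, Γ.src e = v → 0 ≤ Γ.slopeForward f e 0 := by
    intro e he
    obtain ⟨k, hk⟩ := (hf e).exists_hasDerivWithinAt_Ioi le_rfl (Γ.len_pos e)
    have hk' := hk.derivWithin (uniqueDiffWithinAt_Ioi 0)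
    by_contra! hlt
    obtain ⟨a1, a2, a3⟩ := hbounds e
    obtain ⟨b1, b2, b3⟩ := hbounds' e
    have hmin := hv (Γ.tgt e)
    rw [← he] at hmin
    unfold slopeForward at hlt
    rw [hk'] at hlt a1 a3
    have hk1 : (k : ℝ) ≤ -1 := by
      have : k < 0 := by exact_mod_cast hlt
      exact_mod_cast (by omega : k ≤ -1)
    have h0 := (θ e).2.1
    have h1 := (θ e).2.2
    nlinarith [hmid e]
  have htgt : ∀ e, Γ.tgt e = v → 0 ≤ Γ.slopeBackward f e (Γ.len e) := by
    intro e he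
    obtain ⟨k, hk⟩ := (hf e).exists_hasDerivWithinAt_Iio (Γ.len_pos e) le_rfl
    have hk' := hk.derivWithin (uniqueDiffWithinAt_Iio _)
    by_contra! hlt
    obtain ⟨a1, a2, a3⟩ := hbounds e
    obtain ⟨b1, b2, b3⟩ := hbounds' e
    have hmin := hv (Γ.src e)
    rw [← he] at hmin
    unfold slopeBackward at hlt
    rw [hk'] at hlt b2 b3
    have hk1 : (1 : ℝ) ≤ k := by
      have : 0 < k := by exact_mod_cast (by linarith : (0 : ℝ) < k)
      exact_mod_cast (by omega : 1 ≤ k)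
    have h0 := (θ e).2.1
    have h1 := (θ e).2.2
    nlinarith [hmid e]
  refine absurd hneg (not_lt.2 ?_)
  refine add_nonneg (Finset.sum_nonneg fun e he => hsrc e ?_)
    (Finset.sum_nonneg fun e he => htgt e ?_)
  · simpa using he
  · simpa using he

end Ord

end MetricGraph

/-! ### Sums of ceilings -/

/-- The ceiling is left continuous, and its right limit at `τ` is `⌊τ⌋ + 1`. -/
lemma eventually_ceil_add_mul (τ c : ℝ) : ∀ᶠ ε in nhdsWithin (0 : ℝ) (Set.Ioi 0),
    ⌈τ + ε * c⌉ = if 0 < c then ⌊τ⌋ + 1 else ⌈τ⌉ := by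
  have hcont : Filter.Tendsto (fun ε : ℝ => τ + ε * c) (nhdsWithin 0 (Set.Ioi 0)) (nhds τ) := by
    have : ContinuousAt (fun ε : ℝ => τ + ε * c) 0 := by fun_prop
    simpa using this.tendsto.mono_left nhdsWithin_le_nhds
  split_ifs with hc
  · filter_upwards [hcont.eventually (gt_mem_nhds (Int.lt_floor_add_one τ)),
      self_mem_nhdsWithin] with ε h1 h2
    rw [Int.ceil_eq_iff]
    push_cast
    have := mul_pos (Set.mem_Ioi.1 h2) hc
    constructor <;> linarith [Int.floor_le τ]
  · filter_upwards [hcont.eventually (lt_mem_nhds (by linarith [Int.ceil_lt_add_one τ] :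
      (⌈τ⌉ : ℝ) - 1 < τ)), self_mem_nhdsWithin] with ε h1 h2
    rw [Int.ceil_eq_iff]
    have := mul_nonpos_of_nonneg_of_nonpos (Set.mem_Ioi.1 h2).le (not_lt.1 hc)
    exact ⟨h1, by linarith [Int.le_ceil τ]⟩

lemma ceil_neg_add_ceil_of_notMem {K : AddSubgroup ℝ} (h1 : (1 : ℝ) ∈ K) {t : ℝ} (ht : t ∉ K) :
    ⌈-t⌉ = 1 - ⌈t⌉ := by
  have hne : t ≠ ⌊t⌋ := fun h => ht (by
    rw [h]
    simpa using zsmul_mem h1 ⌊t⌋)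
  have hlt : (⌊t⌋ : ℝ) < t := lt_of_le_of_ne (Int.floor_le t) hne.symm
  have h2 : ⌈t⌉ = ⌊t⌋ + 1 := by
    rw [Int.ceil_eq_iff]
    push_cast
    exact ⟨by linarith, (Int.lt_floor_add_one t).le⟩
  rw [Int.ceil_neg, h2]
  ring

lemma floor_add_one_eq_ceil_of_notMem {K : AddSubgroup ℝ} (h1 : (1 : ℝ) ∈ K) {t : ℝ}
    (ht : t ∉ K) : ⌊t⌋ + 1 = ⌈t⌉ := by
  have := ceil_neg_add_ceil_of_notMem h1 ht
  rw [Int.ceil_neg] at this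
  omega

/-- The function `a ↦ ∑ j, ⌈s j + a⌉` takes every integer value when its jumps are separate. -/
lemma exists_sum_ceil_eq {κ : Type*} [Fintype κ] [Nonempty κ] {K : AddSubgroup ℝ}
    (hK : Dense (K : Set ℝ)) (h1 : (1 : ℝ) ∈ K) {s : κ → ℝ}
    (hs : Pairwise fun j j' => s j - s j' ∉ K) (a₀ : ℝ) (k : ℤ) :
    ∃ a, a - a₀ ∈ K ∧ ∑ j, ⌈s j + a⌉ = k := by
  classical
  set N : ℝ → ℤ := fun a => ∑ j, ⌈s j + a⌉ with hN
  have hmono : Monotone N := fun a b hab =>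
    Finset.sum_le_sum fun j _ => Int.ceil_mono (by linarith)
  have hcard : (1 : ℝ) ≤ Fintype.card κ := by exact_mod_cast Fintype.card_pos
  have hlow : ∀ a, ∑ j, s j + Fintype.card κ * a ≤ N a := fun a => by
    have : ∑ j, (s j + a) ≤ ∑ j, (⌈s j + a⌉ : ℝ) := Finset.sum_le_sum fun j _ => Int.le_ceil _
    rw [Finset.sum_add_distrib] at this
    simpa [hN] using this
  have hupp : ∀ a, (N a : ℝ) ≤ ∑ j, s j + Fintype.card κ * (a + 1) := fun a => by
    have : ∑ j, (⌈s j + a⌉ : ℝ) ≤ ∑ j, (s j + (a + 1)) :=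
      Finset.sum_le_sum fun j _ => by linarith [Int.ceil_lt_add_one (s j + a)]
    rw [Finset.sum_add_distrib] at this
    simpa [hN, mul_add] using this
  set M := |(k : ℝ) - ∑ j, s j| with hM
  have hM0 : 0 ≤ M := abs_nonneg _
  have hM1 := le_abs_self ((k : ℝ) - ∑ j, s j)
  have hM2 := neg_abs_le ((k : ℝ) - ∑ j, s j)
  rw [← hM] at hM1 hM2
  have hne : {a | N a ≤ k}.Nonempty := by
    refine ⟨-M - 1, ?_⟩
    have : (N (-M - 1) : ℝ) ≤ k := (hupp _).trans (by nlinarith)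
    exact_mod_cast this
  have hbdd : BddAbove {a | N a ≤ k} := by
    refine ⟨M, fun a ha => ?_⟩
    have h2 : (N a : ℝ) ≤ k := by exact_mod_cast ha
    by_contra! hlt
    nlinarith [hlow a]
  -- `N` is left continuous, and its jump at `t` is at most `1`: two simultaneous jumps would put
  -- some `s j - s j'` into `K`. Hence `N = k` at `t` and just to its left, where the dense coset
  -- `a₀ + K` has a point.
  set t := sSup {a | N a ≤ k} with ht
  have hleft : ∀ a < t, N a ≤ k := fun a ha => by
    obtain ⟨b, hb, hab⟩ := exists_lt_of_lt_csSup hne ha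
    exact (hmono hab.le).trans hb
  have hright : ∀ a > t, k + 1 ≤ N a := fun a ha => by
    by_contra! hlt
    exact absurd (le_csSup hbdd (Int.lt_add_one_iff.1 hlt : a ∈ {a | N a ≤ k})) (not_le.2 ha)
  have hl : ∀ᶠ ε in nhdsWithin (0 : ℝ) (Set.Ioi 0), N (t + ε * (-1)) = N t := by
    filter_upwards [Filter.eventually_all.2 fun j => eventually_ceil_add_mul (s j + t) (-1)]
      with ε hε
    refine Finset.sum_congr rfl fun j _ => ?_
    rw [← add_assoc, hε j, if_neg (by norm_num)]
  have hr : ∀ᶠ ε in nhdsWithin (0 : ℝ) (Set.Ioi 0), N (t + ε * 1) = ∑ j, (⌊s j + t⌋ + 1) := by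
    filter_upwards [Filter.eventually_all.2 fun j => eventually_ceil_add_mul (s j + t) 1]
      with ε hε
    refine Finset.sum_congr rfl fun j _ => ?_
    rw [← add_assoc, hε j, if_pos (by norm_num)]
  have hNt : N t ≤ k := by
    obtain ⟨ε, h2, h3⟩ := (hl.and self_mem_nhdsWithin).exists
    rw [← h2]
    exact hleft _ (by linarith [show 0 < ε from h3])
  have hjump : ∑ j, (⌊s j + t⌋ + 1) ≤ N t + 1 := by
    by_cases hex : ∃ j, s j + t ∈ K
    · obtain ⟨j, hj⟩ := hex
      have hNj : N t = _ := (Finset.add_sum_erase _ (fun j => ⌈s j + t⌉) (Finset.mem_univ j)).symm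
      rw [hNj, ← Finset.add_sum_erase _ _ (Finset.mem_univ j)]
      have h2 : ∑ i ∈ Finset.univ.erase j, (⌊s i + t⌋ + 1) =
          ∑ i ∈ Finset.univ.erase j, ⌈s i + t⌉ :=
        Finset.sum_congr rfl fun i hi => floor_add_one_eq_ceil_of_notMem h1 fun hi' =>
          hs (Finset.ne_of_mem_erase hi) (by simpa using K.sub_mem hi' hj)
      rw [h2]
      have := Int.floor_le_ceil (s j + t)
      omega
    · push Not at hex
      exact (Finset.sum_congr rfl fun i _ => floor_add_one_eq_ceil_of_notMem h1 (hex i)).trans_le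
        (le_add_of_nonneg_right zero_le_one)
  have hNt' : N t = k := by
    obtain ⟨ε, h2, h3⟩ := (hr.and self_mem_nhdsWithin).exists
    have := hright (t + ε * 1) (by linarith [show 0 < ε from h3])
    omega
  obtain ⟨ε, h2, h3⟩ := (hl.and self_mem_nhdsWithin).exists
  obtain ⟨c, hc, hcK⟩ := hK.exists_between
    (show t - ε - a₀ < t - a₀ by linarith [show 0 < ε from h3])
  refine ⟨c + a₀, by simpa using hc, le_antisymm ?_ ?_⟩
  · exact (hmono (by linarith [hcK.2] : c + a₀ ≤ t)).trans_eq hNt'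
  · calc k = N (t + ε * (-1)) := by rw [h2, hNt']
      _ ≤ _ := hmono (by linarith [hcK.1])

lemma ceil_diff_le_one_or_ge_one {κ : Type*} (s : κ → ℝ) (a b : ℝ) :
    (∀ j, ⌈s j + b⌉ - ⌈s j + a⌉ ≤ 1) ∨ (∀ j, 1 ≤ ⌈s j + b⌉ - ⌈s j + a⌉) := by
  rcases le_total b (a + 1) with h | h
  · left
    intro j
    have : ⌈s j + b⌉ ≤ ⌈s j + a + 1⌉ := Int.ceil_mono (by linarith)
    rw [Int.ceil_add_one] at this
    omega
  · right
    intro j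
    have : ⌈s j + a + 1⌉ ≤ ⌈s j + b⌉ := Int.ceil_mono (by linarith)
    rw [Int.ceil_add_one] at this
    omega

lemma sum_max_of_sign {κ : Type*} [Fintype κ] {d : κ → ℤ} (hd : (∀ j, 0 ≤ d j) ∨ ∀ j, d j ≤ 0) :
    ∑ j, max (d j) 0 = max (∑ j, d j) 0 := by
  rcases hd with h | h
  · rw [max_eq_left (Finset.sum_nonneg fun j _ => h j)]
    exact Finset.sum_congr rfl fun j _ => max_eq_left (h j)
  · rw [max_eq_right (Finset.sum_nonpos fun j _ => h j)]
    exact Finset.sum_eq_zero fun j _ => max_eq_right (h j)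

lemma max_sum_le {κ : Type*} (s : Finset κ) (d : κ → ℤ) :
    max (∑ j ∈ s, d j) 0 ≤ ∑ j ∈ s, max (d j) 0 :=
  max_le (Finset.sum_le_sum fun _ _ => le_max_left _ _)
    (Finset.sum_nonneg fun _ _ => le_max_right _ _)

/-- In an integer matrix whose rows have constant sign and whose positive column sums
do not lose anything by cancellation, the positive and the negative part live in
complementary blocks. -/
lemma rectangle_bounds {ι κ : Type*} [Fintype ι] [Fintype κ] (d : κ → ι → ℤ)
    (hsign : ∀ j, (∀ i, 0 ≤ d j i) ∨ ∀ i, d j i ≤ 0)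
    (hpos : ∀ j, (∀ i, d j i ≤ 1) ∨ ∀ i, 1 ≤ d j i)
    (hneg : ∀ j, (∀ i, -1 ≤ d j i) ∨ ∀ i, d j i ≤ -1)
    (hmin : ∑ j, max (∑ i, d j i) 0 ≤ ∑ i, max (∑ j, d j i) 0) :
    ∑ j, max (∑ i, d j i) 0 = 0 ∨ ∑ j, max (-∑ i, d j i) 0 = 0 ∨
    ∃ w h : ℤ, 1 ≤ w ∧ w ≤ Fintype.card ι ∧ 1 ≤ h ∧ h ≤ Fintype.card κ ∧
      ∑ j, max (∑ i, d j i) 0 ≤ w * h ∧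
      ∑ j, max (-∑ i, d j i) 0 ≤ (Fintype.card ι - w) * (Fintype.card κ - h) := by
  classical
  -- Constant signs make the row sums account for the whole positive part, so `hmin` leaves no room
  -- for cancellation in any column.
  have hcol : ∀ i, max (∑ j, d j i) 0 = ∑ j, max (d j i) 0 := by
    have h1 : ∑ j, max (∑ i, d j i) 0 = ∑ i, ∑ j, max (d j i) 0 := by
      rw [Finset.sum_comm]
      exact Finset.sum_congr rfl fun j _ => (sum_max_of_sign (hsign j)).symm
    have h2 : ∑ i, max (∑ j, d j i) 0 = ∑ i, ∑ j, max (d j i) 0 :=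
      le_antisymm (Finset.sum_le_sum fun i _ => max_sum_le _ _) (h1 ▸ hmin)
    intro i
    exact (Finset.sum_eq_sum_iff_of_le fun i _ => max_sum_le _ _).1 h2 i (Finset.mem_univ i)
  have hdisj : ∀ i j j', 0 < d j i → ¬ d j' i < 0 := by
    intro i j j' hj hj'
    have h1 := hcol i
    have h2 : 0 < ∑ j, max (d j i) 0 := Finset.sum_pos' (fun _ _ => le_max_right _ _)
      ⟨j, Finset.mem_univ j, lt_max_of_lt_left hj⟩
    have h3 : ∑ j, d j i < ∑ j, max (d j i) 0 := Finset.sum_lt_sum (fun _ _ => le_max_left _ _)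
      ⟨j', Finset.mem_univ j', lt_max_of_lt_right hj'⟩
    rcases max_choice (∑ j, d j i) 0 with h | h <;> omega
  set Ip := Finset.univ.filter (fun i => ∃ j, 0 < d j i) with hIp
  set In := Finset.univ.filter (fun i => ∃ j, d j i < 0) with hIn
  set Jp := Finset.univ.filter (fun j => 0 < ∑ i, d j i) with hJp
  set Jn := Finset.univ.filter (fun j => ∑ i, d j i < 0) with hJn
  have hI : (Ip.card : ℤ) + In.card ≤ Fintype.card ι := by
    rw [← Nat.cast_add, ← Finset.card_union_of_disjoint]
    · exact_mod_cast Finset.card_le_univ _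
    · rw [Finset.disjoint_left]
      intro i hi hi'
      obtain ⟨j, hj⟩ := (Finset.mem_filter.1 hi).2
      obtain ⟨j', hj'⟩ := (Finset.mem_filter.1 hi').2
      exact hdisj i j j' hj hj'
  have hJ : (Jp.card : ℤ) + Jn.card ≤ Fintype.card κ := by
    rw [← Nat.cast_add, ← Finset.card_union_of_disjoint]
    · exact_mod_cast Finset.card_le_univ _
    · rw [Finset.disjoint_left]
      intro j hj hj'
      exact lt_asymm (Finset.mem_filter.1 hj).2 (Finset.mem_filter.1 hj').2
  have hP : ∑ j, max (∑ i, d j i) 0 = ∑ j ∈ Jp, ∑ i, d j i := by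
    rw [hJp, Finset.sum_filter]
    exact Finset.sum_congr rfl fun j _ => by split_ifs <;> omega
  have hQ : ∑ j, max (-∑ i, d j i) 0 = ∑ j ∈ Jn, -∑ i, d j i := by
    rw [hJn, Finset.sum_filter]
    exact Finset.sum_congr rfl fun j _ => by split_ifs <;> omega
  rw [hP, hQ]
  -- Such a row puts a positive entry in every column, and then no entry at all is negative.
  by_cases hcp : ∃ j ∈ Jp, ∀ i, 1 ≤ d j i
  · obtain ⟨j, -, hj⟩ := hcp
    right; left
    refine Finset.sum_eq_zero fun j' hj' => absurd (Finset.mem_filter.1 hj').2 (not_lt.2 ?_)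
    exact Finset.sum_nonneg fun i _ => not_lt.1 (hdisj i j j' (by have := hj i; omega))
  by_cases hcn : ∃ j ∈ Jn, ∀ i, d j i ≤ -1
  · obtain ⟨j, -, hj⟩ := hcn
    left
    refine Finset.sum_eq_zero fun j' hj' => absurd (Finset.mem_filter.1 hj').2 (not_lt.2 ?_)
    exact Finset.sum_nonpos fun i _ => not_lt.1 fun h => hdisj i j' j h (by have := hj i; omega)
  push Not at hcp hcn
  rcases Jp.eq_empty_or_nonempty with he | ⟨j₀, hj₀⟩
  · left
    rw [he, Finset.sum_empty]
  right; right
  -- The remaining positive rows have entries `0` and `1`, with the ones confined to the columns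
  -- `Ip`.
  have hp : ∑ j ∈ Jp, ∑ i, d j i ≤ Jp.card * Ip.card := by
    rw [← nsmul_eq_mul]
    refine Finset.sum_le_card_nsmul _ _ _ fun j hj => ?_
    have h1 := (hpos j).resolve_right fun h => by
      obtain ⟨i, hi⟩ := hcp j hj
      have := h i
      omega
    calc ∑ i, d j i ≤ ∑ i, if 0 < d j i then 1 else 0 :=
          Finset.sum_le_sum fun i _ => by have := h1 i; split_ifs <;> omega
      _ = ((Finset.univ.filter fun i => 0 < d j i).card : ℤ) := by simp
      _ ≤ Ip.card := by
        refine Nat.cast_le.2 (Finset.card_le_card fun i hi => ?_)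
        exact Finset.mem_filter.2 ⟨Finset.mem_univ i, j, (Finset.mem_filter.1 hi).2⟩
  have hn : ∑ j ∈ Jn, -∑ i, d j i ≤ Jn.card * In.card := by
    rw [← nsmul_eq_mul]
    refine Finset.sum_le_card_nsmul _ _ _ fun j hj => ?_
    have h1 := (hneg j).resolve_right fun h => by
      obtain ⟨i, hi⟩ := hcn j hj
      have := h i
      omega
    rw [← Finset.sum_neg_distrib]
    calc ∑ i, -d j i ≤ ∑ i, if d j i < 0 then 1 else 0 :=
          Finset.sum_le_sum fun i _ => by have := h1 i; split_ifs <;> omega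
      _ = ((Finset.univ.filter fun i => d j i < 0).card : ℤ) := by simp
      _ ≤ In.card := by
        refine Nat.cast_le.2 (Finset.card_le_card fun i hi => ?_)
        exact Finset.mem_filter.2 ⟨Finset.mem_univ i, j, (Finset.mem_filter.1 hi).2⟩
  have hIp1 : 1 ≤ Ip.card := by
    obtain ⟨i, -, hi⟩ := Finset.exists_lt_of_sum_lt
      (show ∑ i : ι, (0 : ℤ) < ∑ i, d j₀ i by simpa using (Finset.mem_filter.1 hj₀).2)
    exact Finset.card_pos.2 ⟨i, Finset.mem_filter.2 ⟨Finset.mem_univ i, j₀, hi⟩⟩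
  have hJp1 : 1 ≤ Jp.card := Finset.card_pos.2 ⟨j₀, hj₀⟩
  refine ⟨Ip.card, Jp.card, by exact_mod_cast hIp1, by omega, by exact_mod_cast hJp1, by omega,
    by rw [mul_comm]; exact hp, hn.trans ?_⟩
  rw [mul_comm]
  exact mul_le_mul (by omega) (by omega) (by positivity) (by omega)

/-! ### Chip configurations with one chip inside every edge -/

section Excess

variable {ι κ : Type*}

/-- Potentials in pairwise distinct cosets of `K`. -/
structure Generic (K : AddSubgroup ℝ) (α : ι → ℝ) (β : κ → ℝ) : Prop where
  left : Pairwise fun i i' => α i - α i' ∉ K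
  right : Pairwise fun j j' => β j - β j' ∉ K
  cross : ∀ i j, α i - β j ∉ K

/-- One more than the number of chips at the vertex `i`, when the potentials `α`, `β` are
applied to a divisor with `x i` chips near `i` and total positions `σ i j` on the edges. -/
noncomputable def excess [Fintype κ] (σ : ι → κ → ℝ) (x : ι → ℤ) (α : ι → ℝ) (β : κ → ℝ)
    (i : ι) : ℤ :=
  x i + 1 - ∑ j, ⌈σ i j + α i - β j⌉

/-- The edge data seen from the other side. -/
def negFlip (σ : ι → κ → ℝ) : κ → ι → ℝ := fun j i => -σ i j

lemma negFlip_negFlip (σ : ι → κ → ℝ) : negFlip (negFlip σ) = σ := by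
  funext i j
  simp [negFlip]

namespace Generic

variable {K : AddSubgroup ℝ} {α : ι → ℝ} {β : κ → ℝ}

lemma symm (h : Generic K α β) : Generic K β α :=
  ⟨h.right, h.left, fun j i hij => h.cross i j (by simpa using K.neg_mem hij)⟩

lemma of_sub_mem (h : Generic K α β) {α' : ι → ℝ} (hα : ∀ i, α' i - α i ∈ K) :
    Generic K α' β where
  left i i' hii hK := h.left hii (by
    have := K.add_mem (K.sub_mem hK (hα i)) (hα i')
    ring_nf at this
    simpa [sub_eq_add_neg, add_comm] using this)
  right := h.right
  cross i j hK := h.cross i j (by simpa using K.sub_mem hK (hα i))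

variable {σ : ι → κ → ℝ}

lemma flow_notMem (hσ : ∀ i j, σ i j ∈ K) (h : Generic K α β) (i : ι) (j : κ) :
    σ i j + α i - β j ∉ K := fun hK =>
  h.cross i j (by
    have := K.sub_mem hK (hσ i j)
    ring_nf at this
    simpa [sub_eq_add_neg, add_comm] using this)

lemma ceil_negFlip (hσ : ∀ i j, σ i j ∈ K) (h1 : (1 : ℝ) ∈ K) (h : Generic K α β) (i : ι) (j : κ) :
    ⌈negFlip σ j i + β j - α i⌉ = 1 - ⌈σ i j + α i - β j⌉ := by
  rw [← ceil_neg_add_ceil_of_notMem h1 (h.flow_notMem hσ i j)]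
  refine congrArg Int.ceil ?_
  simp only [negFlip]
  ring

/-- The ceilings of an edge seen from its two ends add up to `1`, so the potentials drop out. -/
lemma sum_excess [Fintype ι] [Fintype κ] (hσ : ∀ i j, σ i j ∈ K) (h1 : (1 : ℝ) ∈ K)
    (h : Generic K α β) (x : ι → ℤ) (y : κ → ℤ) :
    ∑ i, excess σ x α β i + ∑ j, excess (negFlip σ) y β α j =
      ∑ i, x i + ∑ j, y j + Fintype.card ι + Fintype.card κ - Fintype.card ι * Fintype.card κ := by
  simp only [excess, h.ceil_negFlip hσ h1, Finset.sum_sub_distrib, Finset.sum_add_distrib]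
  rw [Finset.sum_comm (f := fun (j : κ) (i : ι) => ⌈σ i j + α i - β j⌉)]
  simp
  ring

/-- The excess at `i` involves `α` only through `α i`, so each vertex is balanced separately.
Staying in the coset `α i + K` preserves genericity. -/
lemma exists_excess_eq_zero [Fintype κ] [Nonempty κ] (hσ : ∀ i j, σ i j ∈ K)
    (hK : Dense (K : Set ℝ)) (h1 : (1 : ℝ) ∈ K)
    (h : Generic K α β) (x : ι → ℤ) :
    ∃ α' : ι → ℝ, Generic K α' β ∧ ∀ i, excess σ x α' β i = 0 := by
  have : ∀ i, ∃ a, a - α i ∈ K ∧ ∑ j, ⌈σ i j - β j + a⌉ = x i + 1 := fun i =>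
    exists_sum_ceil_eq hK h1 (fun j j' hjj hmem => h.right hjj (by
      have := K.sub_mem (K.sub_mem (hσ i j) (hσ i j')) hmem
      ring_nf at this
      simpa [sub_eq_add_neg, add_comm] using this)) _ _
  choose α' hα' hsum using this
  refine ⟨α', h.of_sub_mem hα', fun i => ?_⟩
  rw [excess, ← hsum i, sub_eq_zero]
  exact Finset.sum_congr rfl fun j _ => by congr 1; ring

end Generic

/-- The change of `⌈σ i j + α i - β j⌉` when `α` is replaced by `α'`. -/
noncomputable def flowChange (σ : ι → κ → ℝ) (α α' : ι → ℝ) (β : κ → ℝ) (i : ι) (j : κ) : ℤ :=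
  ⌈σ i j + α' i - β j⌉ - ⌈σ i j + α i - β j⌉

lemma flowChange_sign (σ : ι → κ → ℝ) (α α' : ι → ℝ) (β : κ → ℝ) (i : ι) :
    (∀ j, 0 ≤ flowChange σ α α' β i j) ∨ ∀ j, flowChange σ α α' β i j ≤ 0 := by
  rcases le_total (α i) (α' i) with h | h
  · exact Or.inl fun j => sub_nonneg.2 (Int.ceil_mono (by linarith))
  · exact Or.inr fun j => sub_nonpos.2 (Int.ceil_mono (by linarith))

lemma flowChange_le_one_or (σ : ι → κ → ℝ) (α α' : ι → ℝ) (β : κ → ℝ) (i : ι) :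
    (∀ j, flowChange σ α α' β i j ≤ 1) ∨ ∀ j, 1 ≤ flowChange σ α α' β i j := by
  convert ceil_diff_le_one_or_ge_one (fun j => σ i j - β j) (α i) (α' i) using 3 <;>
  · simp only [flowChange]
    ring_nf

lemma flowChange_ge_neg_one_or (σ : ι → κ → ℝ) (α α' : ι → ℝ) (β : κ → ℝ) (i : ι) :
    (∀ j, -1 ≤ flowChange σ α α' β i j) ∨ ∀ j, flowChange σ α α' β i j ≤ -1 := by
  refine (flowChange_le_one_or σ α' α β i).imp (fun h j => ?_) fun h j => ?_ <;>
  · have := h j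
    simp only [flowChange] at this ⊢
    omega

lemma sum_flowChange [Fintype κ] (σ : ι → κ → ℝ) (x : ι → ℤ) (α α' : ι → ℝ) (β : κ → ℝ) (i : ι) :
    ∑ j, flowChange σ α α' β i j = excess σ x α β i - excess σ x α' β i := by
  simp only [flowChange, excess, Finset.sum_sub_distrib]
  ring

/-- Chips leaving `i` along an edge arrive at its other end. -/
lemma excess_negFlip_eq_add [Fintype ι] {K : AddSubgroup ℝ} {σ : ι → κ → ℝ} (hσ : ∀ i j, σ i j ∈ K)
    (h1 : (1 : ℝ) ∈ K) {α α' : ι → ℝ} {β : κ → ℝ} (h : Generic K α β) (h' : Generic K α' β)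
    (y : κ → ℤ) (j : κ) :
    excess (negFlip σ) y β α' j = excess (negFlip σ) y β α j + ∑ i, flowChange σ α α' β i j := by
  simp only [excess, h.ceil_negFlip hσ h1, h'.ceil_negFlip hσ h1, flowChange,
    Finset.sum_sub_distrib]
  ring

variable [Fintype ι] [Fintype κ]

/-- The total positive excess. -/
noncomputable def posExcess (σ : ι → κ → ℝ) (x : ι → ℤ) (y : κ → ℤ) (α : ι → ℝ) (β : κ → ℝ) : ℤ :=
  ∑ i, max (excess σ x α β i) 0 + ∑ j, max (excess (negFlip σ) y β α j) 0

/-- The total negative excess. -/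
noncomputable def negExcess (σ : ι → κ → ℝ) (x : ι → ℤ) (y : κ → ℤ) (α : ι → ℝ) (β : κ → ℝ) : ℤ :=
  ∑ i, max (-excess σ x α β i) 0 + ∑ j, max (-excess (negFlip σ) y β α j) 0

lemma posExcess_nonneg (σ : ι → κ → ℝ) (x : ι → ℤ) (y : κ → ℤ) (α : ι → ℝ) (β : κ → ℝ) :
    0 ≤ posExcess σ x y α β :=
  add_nonneg (Finset.sum_nonneg fun _ _ => le_max_right _ _)
    (Finset.sum_nonneg fun _ _ => le_max_right _ _)

lemma posExcess_sub_negExcess (σ : ι → κ → ℝ) (x : ι → ℤ) (y : κ → ℤ) (α : ι → ℝ) (β : κ → ℝ) :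
    posExcess σ x y α β - negExcess σ x y α β =
      ∑ i, excess σ x α β i + ∑ j, excess (negFlip σ) y β α j := by
  have h : ∀ z : ℤ, max z 0 - max (-z) 0 = z := fun z => by omega
  calc _ = ∑ i, (max (excess σ x α β i) 0 - max (-excess σ x α β i) 0) +
        ∑ j, (max (excess (negFlip σ) y β α j) 0 - max (-excess (negFlip σ) y β α j) 0) := by
        simp only [posExcess, negExcess, Finset.sum_sub_distrib]
        ring
    _ = _ := by simp only [h]

/-- Each `i` changes its flow on all edges in one direction, so its positive excess is exactly the
positive part of what it sends. On arrival, positive parts can only cancel. -/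
lemma posExcess_le_of_excess_eq_zero {K : AddSubgroup ℝ} {σ : ι → κ → ℝ}
    (hσ : ∀ i j, σ i j ∈ K) (h1 : (1 : ℝ) ∈ K) {α α' : ι → ℝ} {β : κ → ℝ} (h : Generic K α β)
    (h' : Generic K α' β) {x : ι → ℤ} (y : κ → ℤ) (hx : ∀ i, excess σ x α' β i = 0) :
    posExcess σ x y α' β ≤ posExcess σ x y α β := by
  have h2 : ∑ i, max (excess σ x α β i) 0 = ∑ j, ∑ i, max (flowChange σ α α' β i j) 0 := by
    rw [Finset.sum_comm]
    refine Finset.sum_congr rfl fun i _ => ?_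
    rw [sum_max_of_sign (flowChange_sign σ α α' β i), sum_flowChange σ x, hx, sub_zero]
  simp only [posExcess, hx, max_self, Finset.sum_const_zero, zero_add, h2,
    ← Finset.sum_add_distrib]
  refine Finset.sum_le_sum fun j _ => ?_
  rw [excess_negFlip_eq_add hσ h1 h h']
  have := max_sum_le Finset.univ fun i => flowChange σ α α' β i j
  omega

lemma exists_generic_min {K : AddSubgroup ℝ} (σ : ι → κ → ℝ) (x : ι → ℤ) (y : κ → ℤ)
    (hex : ∃ (α : ι → ℝ) (β : κ → ℝ), Generic K α β) :
    ∃ (α : ι → ℝ) (β : κ → ℝ), Generic K α β ∧ ∀ (α' : ι → ℝ) (β' : κ → ℝ), Generic K α' β' →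
      posExcess σ x y α β ≤ posExcess σ x y α' β' := by
  classical
  have hne : ∃ n : ℕ, ∃ (α : ι → ℝ) (β : κ → ℝ), Generic K α β ∧ posExcess σ x y α β = n := by
    obtain ⟨α, β, h⟩ := hex
    exact ⟨_, α, β, h, (Int.toNat_of_nonneg (posExcess_nonneg σ x y α β)).symm⟩
  obtain ⟨α, β, h, hn⟩ := Nat.find_spec hne
  refine ⟨α, β, h, fun α' β' h' => ?_⟩
  have := Nat.find_min' hne ⟨α', β', h', (Int.toNat_of_nonneg (posExcess_nonneg σ x y α' β')).symm⟩
  have := posExcess_nonneg σ x y α' β'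
  omega

/-- Every divisor class has a configuration whose positive and negative excess are
bounded by the areas of complementary rectangles. -/
theorem exists_posExcess_le_rectangle [Nonempty ι] [Nonempty κ] {K : AddSubgroup ℝ}
    (hK : Dense (K : Set ℝ)) (h1 : (1 : ℝ) ∈ K) {σ : ι → κ → ℝ} (hσ : ∀ i j, σ i j ∈ K)
    (x : ι → ℤ) (y : κ → ℤ) (hex : ∃ (α : ι → ℝ) (β : κ → ℝ), Generic K α β) :
    ∃ (α : ι → ℝ) (β : κ → ℝ), Generic K α β ∧
      (posExcess σ x y α β = 0 ∨ negExcess σ x y α β = 0 ∨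
      ∃ w h : ℤ, 1 ≤ w ∧ w ≤ Fintype.card ι ∧ 1 ≤ h ∧ h ≤ Fintype.card κ ∧
        posExcess σ x y α β ≤ w * h ∧
        negExcess σ x y α β ≤ (Fintype.card ι - w) * (Fintype.card κ - h)) := by
  -- Balancing `ι` keeps the minimum, and balancing `κ` afterwards cannot go below it. For the
  -- movement from `β` to `β'` the row sums are the excesses on `κ` before and the column sums those
  -- on `ι` after, so minimality is the last hypothesis of `rectangle_bounds`.
  obtain ⟨α₀, β, h0, hmin⟩ := exists_generic_min σ x y hex
  obtain ⟨α, hα, hαx⟩ := h0.exists_excess_eq_zero hσ hK h1 x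
  have hσ' : ∀ j i, negFlip σ j i ∈ K := fun j i => K.neg_mem (hσ i j)
  obtain ⟨β', hβ', hβy⟩ := hα.symm.exists_excess_eq_zero hσ' hK h1 y
  have hle := posExcess_le_of_excess_eq_zero hσ h1 h0 hα y hαx
  have hrow : ∀ j, ∑ i, flowChange (negFlip σ) β β' α j i =
      excess (negFlip σ) y β α j := fun j => by
    rw [sum_flowChange (negFlip σ) y, hβy, sub_zero]
  have hcol : ∀ i, ∑ j, flowChange (negFlip σ) β β' α j i = excess σ x α β' i := fun i => by
    have := excess_negFlip_eq_add hσ' h1 hα.symm hβ' x i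
    rw [negFlip_negFlip, hαx, zero_add] at this
    exact this.symm
  have hPα : posExcess σ x y α β = ∑ j, max (excess (negFlip σ) y β α j) 0 := by
    simp [posExcess, hαx]
  have hNα : negExcess σ x y α β = ∑ j, max (-excess (negFlip σ) y β α j) 0 := by
    simp [negExcess, hαx]
  have hPβ : posExcess σ x y α β' = ∑ i, max (excess σ x α β' i) 0 := by
    simp [posExcess, hβy]
  refine ⟨α, β, hα, ?_⟩
  have := rectangle_bounds (flowChange (negFlip σ) β β' α) (flowChange_sign _ _ _ _)
    (flowChange_le_one_or _ _ _ _) (flowChange_ge_neg_one_or _ _ _ _)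
  simp only [hrow, hcol] at this
  rw [hPα, hNα]
  refine this ?_
  rw [← hPα, ← hPβ]
  exact hle.trans (hmin _ _ hβ'.symm)

/-- The divisor with `b` chips at the vertices of one part and `a` at those of the other
has large positive excess in every configuration. -/
theorem mul_le_posExcess_const [Nonempty ι] [Nonempty κ] {K : AddSubgroup ℝ}
    (hK : Dense (K : Set ℝ)) (h1 : (1 : ℝ) ∈ K) {a b : ℤ} (ha : 0 ≤ a)
    (ham : a + 1 ≤ Fintype.card ι) {α : ι → ℝ} {β : κ → ℝ} (h : Generic K α β) :
    (a + 1) * (b + 1) ≤ posExcess (fun _ _ => 0) (fun _ => b) (fun _ => a) α β := by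
  have hσ : ∀ (i : ι) (j : κ), (fun (_ : ι) (_ : κ) => (0 : ℝ)) i j ∈ K := fun _ _ => K.zero_mem
  obtain ⟨α', hα', hx⟩ := h.exists_excess_eq_zero hσ hK h1 (fun _ => b)
  refine le_trans ?_ (posExcess_le_of_excess_eq_zero hσ h1 h hα' (fun _ => a) hx)
  obtain ⟨i₀⟩ := ‹Nonempty ι›
  set z : κ → ℤ := fun j => ⌈0 + α' i₀ - β j⌉ with hz
  have hsum : ∀ i, ∑ j, ⌈0 + α' i - β j⌉ = b + 1 := fun i => by
    have := hx i
    rw [excess] at this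
    omega
  -- Any two rows differ by a vector of constant sign and have the same sum, so they coincide.
  have hconst : ∀ i j, ⌈0 + α' i - β j⌉ = z j := by
    intro i j
    have hflow : ∀ j, flowChange (fun _ _ => (0 : ℝ)) (fun _ => α' i₀) (fun _ => α' i) β i j =
        ⌈0 + α' i - β j⌉ - z j := fun j => rfl
    have hs : ∑ j, (⌈0 + α' i - β j⌉ - z j) = 0 := by
      rw [Finset.sum_sub_distrib, hsum, hz, hsum, sub_self]
    have := flowChange_sign (fun _ _ => (0 : ℝ)) (fun _ => α' i₀) (fun _ => α' i) β i
    simp only [hflow] at this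
    rcases this with h | h
    · have := (Finset.sum_eq_zero_iff_of_nonneg fun j _ => h j).1 hs j (Finset.mem_univ j)
      omega
    · have := (Finset.sum_eq_zero_iff_of_nonpos fun j _ => h j).1 hs j (Finset.mem_univ j)
      omega
  have hy : ∀ j, excess (negFlip fun _ _ => (0 : ℝ)) (fun _ => a) β α' j =
      a + 1 - Fintype.card ι * (1 - z j) := fun j => by
    simp only [excess, hα'.ceil_negFlip hσ h1, hconst]
    simp [mul_sub]
  calc (a + 1) * (b + 1) = ∑ j, (a + 1) * z j := by rw [← Finset.mul_sum, hz, hsum]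
    _ ≤ ∑ j, max (excess (negFlip fun _ _ => (0 : ℝ)) (fun _ => a) β α' j) 0 := by
        -- The excess differs from `(a + 1) * z j` by `(card ι - a - 1) * (z j - 1)`, which is
        -- nonnegative for `z j ≥ 1`.
        refine Finset.sum_le_sum fun j _ => ?_
        rw [hy]
        rcases le_or_gt (z j) 0 with hj | hj
        · exact le_max_of_le_right (by nlinarith)
        · exact le_max_of_le_left (by nlinarith)
    _ ≤ _ := le_add_of_nonneg_left (Finset.sum_nonneg fun _ _ => le_max_right _ _)

end Excess

/-! ### Existence of generic potentials -/

/-- The rational span of `1` and the `σ i j` serves: it contains `ℚ`, and finitely many generators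
keep it countable. -/
lemma exists_countable_dense_addSubgroup {ι κ : Type*} [Fintype ι] [Fintype κ] (σ : ι → κ → ℝ) :
    ∃ K : AddSubgroup ℝ, (K : Set ℝ).Countable ∧ Dense (K : Set ℝ) ∧ (1 : ℝ) ∈ K ∧
      ∀ i j, σ i j ∈ K := by
  classical
  let v : Option (ι × κ) → ℝ := fun o => o.elim 1 fun e => σ e.1 e.2
  let F : (Option (ι × κ) → ℚ) →+ ℝ :=
    { toFun := fun c => ∑ o, (c o : ℝ) * v o
      map_zero' := by simp
      map_add' := fun c d => by simp [add_mul, Finset.sum_add_distrib] }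
  have hF : ∀ (o : Option (ι × κ)) (q : ℚ), (q : ℝ) * v o ∈ F.range := fun o q =>
    ⟨Pi.single o q, by
      change ∑ o', ((Pi.single o q : Option (ι × κ) → ℚ) o' : ℝ) * v o' = _
      rw [Finset.sum_eq_single o] <;> simp +contextual⟩
  refine ⟨F.range, Set.countable_range F, ?_, ?_, fun i j => ?_⟩
  · refine (Rat.denseRange_cast (𝕜 := ℝ)).mono ?_
    rintro _ ⟨q, rfl⟩
    simpa [v] using hF none q
  · simpa [v] using hF none 1
  · simpa [v] using hF (some (i, j)) 1

/-- A countable subgroup has infinitely many cosets in the uncountable group `ℝ`. -/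
lemma exists_pairwise_sub_notMem {W : Type*} [Finite W] {K : AddSubgroup ℝ}
    (hc : (K : Set ℝ).Countable) : ∃ θ : W → ℝ, Pairwise fun w w' => θ w - θ w' ∉ K := by
  have hinf : Infinite (ℝ ⧸ K) := by
    by_contra hfin
    rw [not_infinite_iff_finite] at hfin
    have : Countable K := hc.to_subtype
    have : Countable ((ℝ ⧸ K) × K) := inferInstance
    have : Countable ℝ :=
      (AddSubgroup.addGroupEquivQuotientProdAddSubgroup (s := K)).countable_iff.2 this
    exact not_countable (α := ℝ) this
  obtain ⟨e⟩ : Nonempty (W ↪ ℝ ⧸ K) := by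
    obtain ⟨n, ⟨e⟩⟩ := Finite.exists_equiv_fin W
    exact ⟨e.toEmbedding.trans (Fin.valEmbedding.trans (Infinite.natEmbedding _))⟩
  refine ⟨fun w => (e w).out, fun w w' hww hK => hww.symm (e.injective ?_)⟩
  rw [← QuotientAddGroup.out_eq' (e w), ← QuotientAddGroup.out_eq' (e w'), QuotientAddGroup.eq]
  rw [neg_add_eq_sub]
  exact hK

/-- Translations by the dense subgroup `K` keep the cosets and bring the representatives close to
`φ`. -/
lemma exists_pairwise_sub_notMem_near {W : Type*} [Finite W] {K : AddSubgroup ℝ}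
    (hc : (K : Set ℝ).Countable) (hK : Dense (K : Set ℝ)) {φ : W → ℝ} {p : (W → ℝ) → Prop}
    (hp : ∀ᶠ ψ in nhds φ, p ψ) :
    ∃ ψ : W → ℝ, (Pairwise fun w w' => ψ w - ψ w' ∉ K) ∧ p ψ := by
  have := Fintype.ofFinite W
  obtain ⟨θ, hθ⟩ := exists_pairwise_sub_notMem (W := W) hc
  obtain ⟨ε, hε, hball⟩ := Metric.eventually_nhds_iff.1 hp
  have : ∀ w, ∃ k ∈ K, |θ w + k - φ w| < ε := fun w => by
    obtain ⟨k, hk, h1, h2⟩ := hK.exists_between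
      (show φ w - θ w - ε < φ w - θ w + ε by linarith)
    exact ⟨k, hk, abs_lt.2 ⟨by linarith, by linarith⟩⟩
  choose k hkK hk using this
  refine ⟨fun w => θ w + k w, fun w w' hww hmem => hθ hww ?_, hball ?_⟩
  · have := K.add_mem (K.sub_mem hmem (hkK w)) (hkK w')
    ring_nf at this
    simpa [sub_eq_add_neg, add_comm] using this
  · exact (dist_pi_lt_iff hε).2 fun w => by rw [Real.dist_eq]; exact hk w

lemma Generic.of_pairwise {ι κ : Type*} {K : AddSubgroup ℝ} {φ : ι ⊕ κ → ℝ}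
    (h : Pairwise fun w w' => φ w - φ w' ∉ K) : Generic K (φ ∘ Sum.inl) (φ ∘ Sum.inr) :=
  ⟨fun _ _ hii => h (Sum.inl_injective.ne hii), fun _ _ hjj => h (Sum.inr_injective.ne hjj),
    fun _ _ => h Sum.inl_ne_inr⟩

/-! ### The burning algorithm -/

/-- Lower semicontinuity makes feasibility a closed condition and deficiency an open one: the former
gives compactness, the latter permits generic perturbation. -/
lemma eventually_le_ceil (τ : ℝ) : ∀ᶠ t in nhds τ, ⌈τ⌉ ≤ ⌈t⌉ := by
  filter_upwards [lt_mem_nhds (by linarith [Int.ceil_lt_add_one τ] : (⌈τ⌉ : ℝ) - 1 < τ)] with t ht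
  have : ((⌈τ⌉ - 1 : ℤ) : ℝ) < t := by push_cast; exact ht
  have := Int.lt_ceil.2 this
  omega

section Burning

variable {W : Type*}

/-- The number of chips sent away by the vertex `w` under the potential `φ`. -/
noncomputable def demand (nb : W → Finset W) (s : W → W → ℝ) (φ : W → ℝ) (w : W) : ℤ :=
  ∑ w' ∈ nb w, ⌈s w w' + φ w - φ w'⌉

lemma eventually_demand_le (nb : W → Finset W) (s : W → W → ℝ) (φ : W → ℝ) (w : W) :
    ∀ᶠ ψ in nhds φ, demand nb s φ w ≤ demand nb s ψ w := by
  have : ∀ w' ∈ nb w, ∀ᶠ ψ : W → ℝ in nhds φ,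
      ⌈s w w' + φ w - φ w'⌉ ≤ ⌈s w w' + ψ w - ψ w'⌉ := fun w' _ => by
    have hc : Continuous fun ψ : W → ℝ => s w w' + ψ w - ψ w' := by fun_prop
    exact hc.continuousAt.eventually (eventually_le_ceil _)
  filter_upwards [(Filter.eventually_all_finset _).2 this] with ψ hψ
  exact Finset.sum_le_sum hψ

lemma isClosed_demand_le (nb : W → Finset W) (s : W → W → ℝ) (w : W) (z : ℤ) :
    IsClosed {φ | demand nb s φ w ≤ z} := by
  rw [← isOpen_compl_iff, isOpen_iff_eventually]
  intro φ hφ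
  filter_upwards [eventually_demand_le nb s φ w] with ψ hψ
  simp only [Set.mem_compl_iff, Set.mem_ofPred_eq, not_le] at hφ ⊢
  omega

lemma eventually_demand_add_mul (nb : W → Finset W) (s : W → W → ℝ) (φ o : W → ℝ) (w : W) :
    ∀ᶠ ε in nhdsWithin (0 : ℝ) (Set.Ioi 0), demand nb s (fun w => φ w + ε * o w) w =
      ∑ w' ∈ nb w, if o w' < o w then ⌊s w w' + φ w - φ w'⌋ + 1 else ⌈s w w' + φ w - φ w'⌉ := by
  filter_upwards [(Filter.eventually_all_finset (nb w)).2 fun w' _ =>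
    eventually_ceil_add_mul (s w w' + φ w - φ w') (o w - o w')] with ε hε
  refine Finset.sum_congr rfl fun w' hw' => ?_
  simp only [sub_pos] at hε
  rw [← hε w' hw']
  congr 1
  ring

variable [Fintype W] [DecidableEq W]

/-- If every set of burnt vertices can be enlarged, then the vertices can be ordered in
such a way that no vertex has enough chips to serve the earlier ones. -/
lemma exists_burning_order (nb : W → Finset W) (s : W → W → ℝ) (φ : W → ℝ) (z : W → ℤ)
    (hburn : ∀ B : Finset W, B ≠ Finset.univ → ∃ w ∉ B, z w + 1 ≤
      ∑ w' ∈ nb w, if w' ∈ B then ⌊s w w' + φ w - φ w'⌋ + 1 else ⌈s w w' + φ w - φ w'⌉) :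
    ∃ o : W → ℕ, ∀ w, z w + 1 ≤
      ∑ w' ∈ nb w, if o w' < o w then ⌊s w w' + φ w - φ w'⌋ + 1 else ⌈s w w' + φ w - φ w'⌉ := by
  -- `B` is the set burnt after `k` steps and `o` the burning time. Requiring `w' ∈ B` discards the
  -- meaningless values of `o` at unburnt vertices.
  have hstep : ∀ k ≤ Fintype.card W, ∃ (B : Finset W) (o : W → ℕ), B.card = k ∧
      (∀ w ∈ B, o w < k) ∧ ∀ w ∈ B, z w + 1 ≤ ∑ w' ∈ nb w, if w' ∈ B ∧ o w' < o w
        then ⌊s w w' + φ w - φ w'⌋ + 1 else ⌈s w w' + φ w - φ w'⌉ := by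
    intro k
    induction k with
    | zero => exact fun _ => ⟨∅, fun _ => 0, by simp⟩
    | succ k ih =>
      intro hk
      obtain ⟨B, o, hcard, hlt, hB⟩ := ih (by omega)
      obtain ⟨w, hw, hz⟩ := hburn B fun h => by
        rw [h, Finset.card_univ] at hcard
        omega
      refine ⟨insert w B, Function.update o w k, by rw [Finset.card_insert_of_notMem hw, hcard],
        fun w' hw' => ?_, fun w' hw' => ?_⟩
      · rcases Finset.mem_insert.1 hw' with rfl | h
        · simp
        · rw [Function.update_of_ne (by rintro rfl; exact hw h)]
          exact (hlt w' h).trans (Nat.lt_succ_self k)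
      · rcases Finset.mem_insert.1 hw' with rfl | h
        · refine hz.trans_eq (Finset.sum_congr rfl fun v _ => ?_)
          by_cases hv : v ∈ B
          · have hvw : v ≠ w' := by rintro rfl; exact hw hv
            simp [hv, hvw, hlt v hv]
          · by_cases hvw : v = w' <;> simp [hv, hvw, hw]
        · refine (hB w' h).trans_eq (Finset.sum_congr rfl fun v _ => ?_)
          have hww : w' ≠ w := by rintro rfl; exact hw h
          by_cases hvw : v = w
          · subst hvw
            simp [hw, hww, (hlt w' h).le]
          · simp [hvw, hww]
  obtain ⟨B, o, hcard, -, hB⟩ := hstep _ le_rfl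
  rw [Finset.card_eq_iff_eq_univ] at hcard
  subst hcard
  exact ⟨o, by simpa using hB⟩

/-- A potential that is maximal among those feasible away from `q` is feasible everywhere, or a
small perturbation of it makes every vertex deficient. -/
lemma feasible_or_exists_deficient (nb : W → Finset W) (s : W → W → ℝ) (z : W → ℤ) (q : W)
    (φ : W → ℝ) (hφ : ∀ w ≠ q, demand nb s φ w ≤ z w)
    (hmax : ∀ φ' : W → ℝ, φ' q = φ q → (∀ w, φ w ≤ φ' w) →
      (∀ w ≠ q, demand nb s φ' w ≤ z w) → φ' = φ) :
    (∀ w, demand nb s φ w ≤ z w) ∨ ∃ ψ : W → ℝ, ∀ w, z w + 1 ≤ demand nb s ψ w := by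
  by_cases hq : demand nb s φ q ≤ z q
  · left
    intro w
    by_cases hw : w = q
    · rwa [hw]
    · exact hφ w hw
  right
  -- The fire starts at the infeasible vertex `q`. If it stopped at a proper set `B` containing `q`,
  -- raising `φ` slightly outside `B` would stay feasible away from `q`, against maximality.
  obtain ⟨o, ho⟩ := exists_burning_order nb s φ z fun B hB => by
    by_cases hqB : q ∈ B
    · set c : W → ℝ := fun w => if w ∈ B then 0 else 1 with hc
      obtain ⟨ε, hε, hε0⟩ := ((Filter.eventually_all.2 fun w =>
        eventually_demand_add_mul nb s φ c w).and self_mem_nhdsWithin).exists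
      by_contra! hcon
      have heq := hmax (fun w => φ w + ε * c w) (by simp [hc, hqB]) (fun w => by
        have : 0 ≤ c w := by simp only [hc]; split_ifs <;> norm_num
        have := mul_nonneg (show 0 < ε from hε0).le this
        linarith) (fun w hw => by
          rw [hε w]
          by_cases hwB : w ∈ B
          · refine le_trans (le_of_eq (Finset.sum_congr rfl fun w' _ => if_neg ?_)) (hφ w hw)
            simp only [hc, if_pos hwB]
            split_ifs <;> norm_num
          · refine le_trans (le_of_eq (Finset.sum_congr rfl fun w' _ => ?_))
              (Int.lt_add_one_iff.1 (hcon w hwB))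
            by_cases hw'B : w' ∈ B <;> simp [hc, hwB, hw'B])
      obtain ⟨w, hw⟩ : ∃ w, w ∉ B := by
        by_contra! h
        exact hB (Finset.eq_univ_iff_forall.2 h)
      have := congrFun heq w
      simp [hc, hw] at this
      exact (show 0 < ε from hε0).ne' this
    · refine ⟨q, hqB, Int.add_one_le_iff.2 ((not_le.1 hq).trans_le
        (Finset.sum_le_sum fun w' _ => ?_))⟩
      split_ifs
      · exact Int.ceil_le_floor_add_one _
      · exact le_rfl
  -- Raising each potential by `ε` times its burning time realizes the one-sided limits `⌊·⌋ + 1`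
  -- towards the earlier vertices.
  obtain ⟨ε, hε⟩ := (Filter.eventually_all.2 fun w =>
    eventually_demand_add_mul nb s φ (fun w => (o w : ℝ)) w).exists
  refine ⟨fun w => φ w + ε * o w, fun w => (ho w).trans_eq ?_⟩
  rw [hε w]
  simp only [Nat.cast_lt]

end Burning

/-! ### Effective classes versus generic configurations without positive excess -/

section Duality

variable {ι κ : Type*} [Fintype ι] [Fintype κ]

/-- The neighbours in the complete bipartite graph. -/
def bipartiteNeighbors : ι ⊕ κ → Finset (ι ⊕ κ)
  | Sum.inl _ => Finset.univ.map Function.Embedding.inr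
  | Sum.inr _ => Finset.univ.map Function.Embedding.inl

/-- The edge data as an antisymmetric function of pairs of vertices. -/
def bipartiteFlow (σ : ι → κ → ℝ) : ι ⊕ κ → ι ⊕ κ → ℝ
  | Sum.inl i, Sum.inr j => σ i j
  | Sum.inr j, Sum.inl i => -σ i j
  | _, _ => 0

lemma demand_inl (σ : ι → κ → ℝ) (φ : ι ⊕ κ → ℝ) (i : ι) :
    demand bipartiteNeighbors (bipartiteFlow σ) φ (Sum.inl i) =
      ∑ j, ⌈σ i j + φ (Sum.inl i) - φ (Sum.inr j)⌉ := by
  simp [demand, bipartiteNeighbors, bipartiteFlow]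

lemma demand_inr (σ : ι → κ → ℝ) (φ : ι ⊕ κ → ℝ) (j : κ) :
    demand bipartiteNeighbors (bipartiteFlow σ) φ (Sum.inr j) =
      ∑ i, ⌈negFlip σ j i + φ (Sum.inr j) - φ (Sum.inl i)⌉ := by
  simp [demand, bipartiteNeighbors, bipartiteFlow, negFlip]

/-- Three levels suffice: `q` at `0`, the part `κ` at `-M`, the rest of `ι` lower by `l`. A large
`l` makes the lowest vertices receive enough; then a large `M` lets the supply from `q` cover what
`κ` sends down. -/
lemma exists_feasible_away [Nonempty κ] [DecidableEq ι] (σ : ι → κ → ℝ) (z : ι ⊕ κ → ℤ)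
    (q : ι) : ∃ φ : ι ⊕ κ → ℝ, φ (Sum.inl q) = 0 ∧ ∀ w ≠ Sum.inl q,
      demand bipartiteNeighbors (bipartiteFlow σ) φ w ≤ z w := by
  obtain ⟨c, hc⟩ : ∃ c : ℝ, ∀ i j, |σ i j| ≤ c := by
    refine ⟨∑ i, ∑ j, |σ i j|, fun i j => ?_⟩
    exact (Finset.single_le_sum (f := fun j => |σ i j|) (fun _ _ => abs_nonneg _)
      (Finset.mem_univ j)).trans (Finset.single_le_sum (f := fun i => ∑ j, |σ i j|)
      (fun _ _ => Finset.sum_nonneg fun _ _ => abs_nonneg _) (Finset.mem_univ i))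
  obtain ⟨Z, hZ⟩ : ∃ Z : ℤ, ∀ w, -Z ≤ z w := by
    refine ⟨∑ w, |z w|, fun w => ?_⟩
    have := Finset.single_le_sum (f := fun w => |z w|) (fun _ _ => abs_nonneg _)
      (Finset.mem_univ w)
    have := neg_abs_le (z w)
    linarith
  have hc' : ∀ i j, σ i j ≤ c ∧ -σ i j ≤ c := fun i j =>
    ⟨(le_abs_self _).trans (hc i j), (neg_le_abs _).trans (hc i j)⟩
  obtain ⟨l, hl⟩ : ∃ l : ℝ, l = |c| + |(Z : ℝ)| := ⟨_, rfl⟩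
  have hl0 : 0 ≤ |c| + l := by rw [hl]; positivity
  obtain ⟨M, hM⟩ : ∃ M : ℝ, M = Fintype.card ι * (|c| + l + 1) + c + 1 + Z := ⟨_, rfl⟩
  refine ⟨Sum.elim (fun i => if i = q then 0 else -M - l) fun _ => -M, by simp, ?_⟩
  rintro (i | j) hw
  · have hiq : i ≠ q := fun h => hw (h ▸ rfl)
    rw [demand_inl]
    simp only [Sum.elim_inl, Sum.elim_inr, if_neg hiq]
    have hterm : ∀ j, ⌈σ i j + (-M - l) - -M⌉ ≤ -|Z| := fun j => by
      rw [Int.ceil_le]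
      push_cast
      linarith [(hc' i j).1, le_abs_self c]
    have h1 : (1 : ℤ) ≤ Fintype.card κ := by exact_mod_cast Fintype.card_pos
    have h2 := Finset.sum_le_card_nsmul Finset.univ _ _ fun j _ => hterm j
    rw [nsmul_eq_mul, Finset.card_univ] at h2
    have h3 := hZ (Sum.inl i)
    have h4 := neg_abs_le Z
    have h5 := le_abs_self Z
    have h6 := abs_nonneg Z
    nlinarith
  · rw [demand_inr, ← Finset.add_sum_erase _ _ (Finset.mem_univ q)]
    simp only [Sum.elim_inl, Sum.elim_inr, if_true, negFlip]
    have hterm : ∀ i ∈ Finset.univ.erase q,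
        (⌈-σ i j + -M - (if i = q then 0 else -M - l)⌉ : ℝ) ≤ |c| + l + 1 := fun i hi => by
      rw [if_neg (Finset.ne_of_mem_erase hi)]
      have := Int.ceil_lt_add_one (-σ i j + -M - (-M - l))
      linarith [(hc' i j).2, le_abs_self c]
    have h2 := Finset.sum_le_card_nsmul _ _ _ hterm
    rw [nsmul_eq_mul] at h2
    have h3 : ((Finset.univ.erase q).card : ℝ) ≤ Fintype.card ι := by
      exact_mod_cast Finset.card_le_univ _
    have h4 := Int.ceil_lt_add_one (-σ q j + -M - 0)
    have h5 : (-Z : ℝ) ≤ z (Sum.inr j) := by exact_mod_cast hZ (Sum.inr j)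
    have h6 : ((Finset.univ.erase q).card : ℝ) * (|c| + l + 1) ≤
        Fintype.card ι * (|c| + l + 1) := mul_le_mul_of_nonneg_right h3 (by linarith)
    rw [← Int.cast_le (R := ℝ)]
    push_cast
    linarith [(hc' q j).2]

/-- Summing the inequalities over all vertices but `q` cancels every edge not at `q` and bounds the
sum of the potentials on `κ`. The lower bound `φ₀` then bounds each of them, and the inequality at
`i` bounds `φ (Sum.inl i)`. -/
lemma exists_bound_of_feasible [Nonempty κ] [DecidableEq ι] (σ : ι → κ → ℝ) (z : ι ⊕ κ → ℤ)
    (q : ι) (φ₀ : ι ⊕ κ → ℝ) : ∃ M : ι ⊕ κ → ℝ, ∀ φ : ι ⊕ κ → ℝ, φ (Sum.inl q) = 0 →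
      (∀ w, φ₀ w ≤ φ w) → (∀ w ≠ Sum.inl q,
        demand bipartiteNeighbors (bipartiteFlow σ) φ w ≤ z w) → ∀ w, φ w ≤ M w := by
  classical
  set C : ℝ := ∑ j, (z (Sum.inr j) : ℝ) + ∑ i ∈ Finset.univ.erase q, (z (Sum.inl i) : ℝ) +
    ∑ j, σ q j with hC
  have hn : (1 : ℝ) ≤ Fintype.card κ := by exact_mod_cast Fintype.card_pos
  refine ⟨Sum.elim (fun i => |z (Sum.inl i) - ∑ j, σ i j + C|)
    (fun j => C - ∑ j' ∈ Finset.univ.erase j, φ₀ (Sum.inr j')), fun φ hq h0 hφ => ?_⟩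
  have hinl : ∀ i ≠ q, ∑ j, (σ i j + φ (Sum.inl i) - φ (Sum.inr j)) ≤ z (Sum.inl i) :=
    fun i hi => by
    have h1 := hφ (Sum.inl i) fun h => hi (Sum.inl_injective h)
    rw [demand_inl, ← Int.cast_le (R := ℝ)] at h1
    push_cast at h1
    exact (Finset.sum_le_sum fun j _ => Int.le_ceil _).trans h1
  have hinr : ∀ j, ∑ i, -(σ i j + φ (Sum.inl i) - φ (Sum.inr j)) ≤ z (Sum.inr j) := fun j => by
    have h1 := hφ (Sum.inr j) (by simp)
    rw [demand_inr, ← Int.cast_le (R := ℝ)] at h1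
    push_cast at h1
    refine le_trans (Finset.sum_le_sum fun i _ => le_trans (le_of_eq ?_) (Int.le_ceil _)) h1
    simp only [negFlip]
    ring
  have hsum : ∑ j, φ (Sum.inr j) ≤ C := by
    have h1 := Finset.sum_le_sum fun j (_ : j ∈ Finset.univ) => hinr j
    have h2 := Finset.sum_le_sum fun i (hi : i ∈ Finset.univ.erase q) =>
      hinl i (Finset.ne_of_mem_erase hi)
    rw [Finset.sum_comm, ← Finset.add_sum_erase _ _ (Finset.mem_univ q)] at h1
    simp only [Finset.sum_neg_distrib] at h1
    have h3 : ∑ j, (σ q j + φ (Sum.inl q) - φ (Sum.inr j)) =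
        ∑ j, σ q j - ∑ j, φ (Sum.inr j) := by
      simp [hq, Finset.sum_sub_distrib]
    rw [h3] at h1
    linarith
  rintro (i | j)
  · simp only [Sum.elim_inl]
    by_cases hi : i = q
    · subst hi
      rw [hq]
      exact abs_nonneg _
    · have h1 := hinl i hi
      rw [Finset.sum_sub_distrib, Finset.sum_add_distrib] at h1
      simp only [Finset.sum_const, Finset.card_univ, nsmul_eq_mul] at h1
      by_contra! hlt
      have h2 := le_abs_self ((z (Sum.inl i) : ℝ) - ∑ j, σ i j + C)
      have h3 := abs_nonneg ((z (Sum.inl i) : ℝ) - ∑ j, σ i j + C)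
      nlinarith
  · simp only [Sum.elim_inr]
    rw [← Finset.add_sum_erase _ _ (Finset.mem_univ j)] at hsum
    have := Finset.sum_le_sum fun j' (_ : j' ∈ Finset.univ.erase j) => h0 (Sum.inr j')
    linarith

/-- Either a divisor class contains an effective divisor, or it has a generic configuration
without positive excess. -/
theorem exists_effective_or_generic_nonpos [Nonempty ι] [Nonempty κ] {K : AddSubgroup ℝ}
    (hc : (K : Set ℝ).Countable) (hK : Dense (K : Set ℝ)) (σ : ι → κ → ℝ) (x : ι → ℤ)
    (y : κ → ℤ) :
    (∃ (α : ι → ℝ) (β : κ → ℝ), (∀ i, 1 ≤ excess σ x α β i) ∧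
      ∀ j, 1 ≤ excess (negFlip σ) y β α j) ∨
    ∃ (α : ι → ℝ) (β : κ → ℝ), Generic K α β ∧ (∀ i, excess σ x α β i ≤ 0) ∧
      ∀ j, excess (negFlip σ) y β α j ≤ 0 := by
  classical
  obtain ⟨q⟩ := ‹Nonempty ι›
  set z : ι ⊕ κ → ℤ := Sum.elim x y with hz
  set nb : ι ⊕ κ → Finset (ι ⊕ κ) := bipartiteNeighbors with hnb
  obtain ⟨φ₀, hq0, hφ0⟩ := exists_feasible_away σ z q
  obtain ⟨M, hM⟩ := exists_bound_of_feasible σ z q φ₀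
  set S : Set (ι ⊕ κ → ℝ) := {φ | φ (Sum.inl q) = 0 ∧ (∀ w, φ₀ w ≤ φ w) ∧
    ∀ w ≠ Sum.inl q, demand nb (bipartiteFlow σ) φ w ≤ z w} with hS
  have hclosed : IsClosed S := by
    have hSeq : S = {φ | φ (Sum.inl q) = 0} ∩ (Set.Ici φ₀ ∩
        ⋂ w, ⋂ (_ : w ≠ Sum.inl q), {φ | demand nb (bipartiteFlow σ) φ w ≤ z w}) := by
      ext φ
      simp [hS, Pi.le_def]
    rw [hSeq]
    exact (isClosed_eq (continuous_apply _) continuous_const).inter (isClosed_Ici.inter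
      (isClosed_iInter fun w => isClosed_iInter fun _ => isClosed_demand_le _ _ _ _))
  have hcompact : IsCompact S := (isCompact_Icc (a := φ₀) (b := M)).of_isClosed_subset hclosed
    fun φ hφ => ⟨hφ.2.1, hM φ hφ.1 hφ.2.1 hφ.2.2⟩
  -- A maximizer of the sum is maximal for the pointwise order.
  obtain ⟨φ, hφ, hmax⟩ := hcompact.exists_isMaxOn ⟨φ₀, hq0, fun _ => le_rfl, hφ0⟩
    (f := fun φ => ∑ w, φ w) (by fun_prop)
  rcases feasible_or_exists_deficient nb (bipartiteFlow σ) z (Sum.inl q) φ hφ.2.2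
    (fun φ' hq' hle hφ' => by
      have h1 : ∑ w, φ' w ≤ ∑ w, φ w :=
        hmax ⟨hq'.trans hφ.1, fun w => (hφ.2.1 w).trans (hle w), hφ'⟩
      have h2 := (Finset.sum_eq_sum_iff_of_le fun w _ => hle w).1
        (le_antisymm (Finset.sum_le_sum fun w _ => hle w) h1)
      exact funext fun w => (h2 w (Finset.mem_univ w)).symm) with h | ⟨ψ, hψ⟩
  · left
    refine ⟨φ ∘ Sum.inl, φ ∘ Sum.inr, fun i => ?_, fun j => ?_⟩
    · have := h (Sum.inl i)
      rw [demand_inl] at this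
      simp only [hz, Sum.elim_inl, excess, Function.comp_apply] at this ⊢
      omega
    · have := h (Sum.inr j)
      rw [demand_inr] at this
      simp only [hz, Sum.elim_inr, excess, Function.comp_apply] at this ⊢
      omega
  · right
    obtain ⟨χ, hχ, hle⟩ := exists_pairwise_sub_notMem_near hc hK
      (Filter.eventually_all.2 fun w => eventually_demand_le nb (bipartiteFlow σ) ψ w)
    refine ⟨χ ∘ Sum.inl, χ ∘ Sum.inr, Generic.of_pairwise hχ, fun i => ?_, fun j => ?_⟩
    · have := (hψ (Sum.inl i)).trans (hle _)
      rw [demand_inl] at this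
      simp only [hz, Sum.elim_inl, excess, Function.comp_apply] at this ⊢
      omega
    · have := (hψ (Sum.inr j)).trans (hle _)
      rw [demand_inr] at this
      simp only [hz, Sum.elim_inr, excess, Function.comp_apply] at this ⊢
      omega

end Duality

namespace MetricGraph

/-! ### Chips on an edge -/

section Edge

variable {V E : Type*} [DecidableEq E] {Γ : MetricGraph V E}

/-- The indicator function of the interior of the edge `e`. -/
def Point.onEdge (e : E) : Γ.Point → ℤ
  | .vertex _ => 0
  | .interior e' _ => if e' = e then 1 else 0

/-- The parameter of a point in the interior of the edge `e`, zero for other points. -/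
def Point.posOn (e : E) : Γ.Point → ℝ
  | .vertex _ => 0
  | .interior e' t => if e' = e then t else 0

/-- The piecewise linear function on the edge `e` that has a kink at the given point. -/
noncomputable def Point.hinge (e : E) (p : Γ.Point) (t : ℝ) : ℝ :=
  p.onEdge e * max (t - p.posOn e) 0

/-- The number of chips in the interior of an edge. -/
noncomputable def edgeDeg (D : Γ.Divisor) (e : E) : ℤ := D.sum fun p z => z * p.onEdge e

/-- The sum of the positions of the chips in the interior of an edge. -/
noncomputable def edgePos (D : Γ.Divisor) (e : E) : ℝ := D.sum fun p z => (z : ℝ) * p.posOn e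

lemma edgeDeg_sub (D F : Γ.Divisor) (e : E) : edgeDeg (D - F) e = edgeDeg D e - edgeDeg F e :=
  Finsupp.sum_sub_index fun _ _ _ => sub_mul _ _ _

lemma edgePos_sub (D F : Γ.Divisor) (e : E) : edgePos (D - F) e = edgePos D e - edgePos F e :=
  Finsupp.sum_sub_index fun _ _ _ => by rw [Int.cast_sub, sub_mul]

lemma edgeDeg_eq_zero {D : Γ.Divisor} (h : ∀ e t, D (.interior e t) = 0) (e : E) :
    edgeDeg D e = 0 :=
  Finset.sum_eq_zero fun p _ => by cases p <;> simp [h, Point.onEdge]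

lemma edgePos_eq_zero {D : Γ.Divisor} (h : ∀ e t, D (.interior e t) = 0) (e : E) :
    edgePos D e = 0 :=
  Finset.sum_eq_zero fun p _ => by cases p <;> simp [h, Point.posOn]

lemma edgePos_nonneg {D : Γ.Divisor} (hD : 0 ≤ D) (e : E) : 0 ≤ edgePos D e :=
  Finset.sum_nonneg fun p _ => mul_nonneg (by exact_mod_cast hD p) (by
    cases p with
    | vertex => exact le_rfl
    | interior e' t =>
      simp only [Point.posOn]
      split_ifs
      exacts [t.2.1.le, le_rfl])

lemma edgePos_le {D : Γ.Divisor} (hD : 0 ≤ D) {e : E} (he : Γ.len e = 1) :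
    edgePos D e ≤ edgeDeg D e := by
  rw [edgePos, edgeDeg, Finsupp.sum, Finsupp.sum, Int.cast_sum]
  refine Finset.sum_le_sum fun p _ => ?_
  rw [Int.cast_mul]
  refine mul_le_mul_of_nonneg_left ?_ (by exact_mod_cast hD p)
  cases p with
  | vertex => simp [Point.posOn, Point.onEdge]
  | interior e' t =>
    simp only [Point.posOn, Point.onEdge]
    split_ifs with h
    · subst h
      simpa using t.2.2.le.trans_eq he
    · simp

/-- The degree counts the chips at the vertices and those inside the edges. -/
lemma deg_eq_sum [Fintype V] [Fintype E] (D : Γ.Divisor) :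
    Γ.deg D = ∑ v, D (.vertex v) + ∑ e, edgeDeg D e := by
  classical
  have h1 : ∑ v, D (.vertex v) = D.sum fun p z => ∑ v, if p = .vertex v then z else 0 := by
    rw [Finsupp.sum, Finset.sum_comm]
    refine Finset.sum_congr rfl fun v _ => ?_
    rw [Finset.sum_ite_eq']
    simp +contextual
  have h2 : ∑ e, edgeDeg D e = D.sum fun p z => ∑ e, z * p.onEdge e := by
    simp only [edgeDeg, Finsupp.sum]
    rw [Finset.sum_comm]
  rw [h1, h2, ← Finsupp.sum_add, deg]
  refine Finset.sum_congr rfl fun p _ => ?_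
  cases p <;> simp [Point.onEdge]

lemma hasDerivWithinAt_max_Ioi (p t : ℝ) : HasDerivWithinAt (fun t => max (t - p) 0)
    (if p ≤ t then 1 else 0) (Set.Ioi t) t := by
  split_ifs with h
  · refine hasDerivWithinAt_of_affine_right (lt_add_one t) fun x hx => ?_
    rw [max_eq_left (by linarith [hx.1]), max_eq_left (by linarith)]
    ring
  · refine hasDerivWithinAt_of_affine_right (not_le.1 h) fun x hx => ?_
    rw [max_eq_right (by linarith [hx.2]), max_eq_right (by linarith)]
    ring

lemma hasDerivWithinAt_max_Iio (p t : ℝ) : HasDerivWithinAt (fun t => max (t - p) 0)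
    (if p < t then 1 else 0) (Set.Iio t) t := by
  split_ifs with h
  · refine hasDerivWithinAt_of_affine_left h fun x hx => ?_
    rw [max_eq_left (by linarith [hx.1]), max_eq_left (by linarith)]
    ring
  · refine hasDerivWithinAt_of_affine_left (sub_one_lt t) fun x hx => ?_
    rw [max_eq_right (by linarith [hx.2]), max_eq_right (by linarith)]
    ring

/-- The function on the edge `e` with initial value `A` and slope `k`, and with the divisor `D`
minus one chip at `θ`. -/
noncomputable def edgeFun (D : Γ.Divisor) (e : E) (A : ℝ) (k : ℤ) (θ t : ℝ) : ℝ :=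
  A + k * t + (D.sum fun p z => (z : ℝ) * p.hinge e t) - max (t - θ) 0

lemma isIntegerPL_edgeFun (D : Γ.Divisor) (e : E) (A : ℝ) (k : ℤ) (θ L : ℝ) :
    IsIntegerPL L (edgeFun D e A k θ) :=
  ((IsIntegerPL.affine A k).add (IsIntegerPL.sum _ fun _ _ =>
    ((IsIntegerPL.hinge _).int_mul _).int_mul _)).sub (IsIntegerPL.hinge θ)

lemma hasDerivWithinAt_edgeFun_Ioi (D : Γ.Divisor) (e : E) (A : ℝ) (k : ℤ) (θ t : ℝ) :
    HasDerivWithinAt (edgeFun D e A k θ) (k + (D.sum fun p z => (z : ℝ) * (p.onEdge e *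
      if p.posOn e ≤ t then 1 else 0)) - if θ ≤ t then 1 else 0) (Set.Ioi t) t := by
  refine HasDerivWithinAt.sub (HasDerivWithinAt.add ?_ (HasDerivWithinAt.fun_sum fun _ _ =>
    ((hasDerivWithinAt_max_Ioi _ t).const_mul _).const_mul _)) (hasDerivWithinAt_max_Ioi θ t)
  simpa using (((hasDerivAt_id t).const_mul (k : ℝ)).const_add A).hasDerivWithinAt

lemma hasDerivWithinAt_edgeFun_Iio (D : Γ.Divisor) (e : E) (A : ℝ) (k : ℤ) (θ t : ℝ) :
    HasDerivWithinAt (edgeFun D e A k θ) (k + (D.sum fun p z => (z : ℝ) * (p.onEdge e *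
      if p.posOn e < t then 1 else 0)) - if θ < t then 1 else 0) (Set.Iio t) t := by
  refine HasDerivWithinAt.sub (HasDerivWithinAt.add ?_ (HasDerivWithinAt.fun_sum fun _ _ =>
    ((hasDerivWithinAt_max_Iio _ t).const_mul _).const_mul _)) (hasDerivWithinAt_max_Iio θ t)
  simpa using (((hasDerivAt_id t).const_mul (k : ℝ)).const_add A).hasDerivWithinAt

lemma edgeFun_zero (D : Γ.Divisor) (e : E) (A : ℝ) (k : ℤ) {θ : ℝ} (hθ : 0 ≤ θ) :
    edgeFun D e A k θ 0 = A := by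
  have : (D.sum fun p z => (z : ℝ) * p.hinge e 0) = 0 := Finset.sum_eq_zero fun p _ => by
    cases p with
    | vertex => simp [Point.hinge, Point.onEdge]
    | interior e' t =>
      have := t.2.1.le
      simp only [Point.hinge, Point.onEdge, Point.posOn]
      split_ifs <;> simp [this]
  simp [edgeFun, this, hθ]

lemma edgeFun_one (D : Γ.Divisor) {e : E} (he : Γ.len e = 1) (A : ℝ) (k : ℤ) {θ : ℝ}
    (hθ : θ ≤ 1) : edgeFun D e A k θ 1 = A + k + edgeDeg D e - edgePos D e - (1 - θ) := by
  have : (D.sum fun p z => (z : ℝ) * p.hinge e 1) = edgeDeg D e - edgePos D e := by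
    rw [edgeDeg, edgePos, Finsupp.sum, Finsupp.sum, Finsupp.sum, Int.cast_sum,
      ← Finset.sum_sub_distrib]
    refine Finset.sum_congr rfl fun p _ => ?_
    cases p with
    | vertex => simp [Point.hinge, Point.onEdge, Point.posOn]
    | interior e' t =>
      simp only [Point.hinge, Point.onEdge, Point.posOn]
      split_ifs with h
      · subst h
        have := t.2.2.le.trans_eq he
        rw [max_eq_left (by linarith)]
        push_cast
        ring
      · simp
  rw [edgeFun, this, max_eq_left (by linarith)]
  ring

lemma sum_onEdge_le_zero (D : Γ.Divisor) (e : E) :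
    (D.sum fun p z => (z : ℝ) * (p.onEdge e * if p.posOn e ≤ 0 then (1 : ℝ) else 0)) = 0 :=
  Finset.sum_eq_zero fun p _ => by
    cases p with
    | vertex => simp [Point.onEdge]
    | interior e' t =>
      have := t.2.1
      simp only [Point.onEdge, Point.posOn]
      split_ifs <;> first | linarith | simp

lemma sum_onEdge_lt_one (D : Γ.Divisor) {e : E} (he : Γ.len e = 1) :
    (D.sum fun p z => (z : ℝ) * (p.onEdge e * if p.posOn e < 1 then (1 : ℝ) else 0)) =
      edgeDeg D e := by
  rw [edgeDeg, Finsupp.sum, Finsupp.sum, Int.cast_sum]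
  refine Finset.sum_congr rfl fun p _ => ?_
  cases p with
  | vertex => simp [Point.onEdge]
  | interior e' t =>
    simp only [Point.onEdge, Point.posOn]
    by_cases h : e' = e
    · subst h
      simp [t.2.2.trans_eq he]
    · simp [h]

lemma sum_onEdge_le_sub_lt (D : Γ.Divisor) (e : E) (t : Set.Ioo 0 (Γ.len e)) :
    (D.sum fun p z => (z : ℝ) * (p.onEdge e * if p.posOn e ≤ t then (1 : ℝ) else 0)) -
      (D.sum fun p z => (z : ℝ) * (p.onEdge e * if p.posOn e < t then (1 : ℝ) else 0)) =
      D (.interior e t) := by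
  classical
  have h1 : D (.interior e t) = D.sum fun p z => if p = .interior e t then z else 0 := by
    rw [Finsupp.sum, Finset.sum_ite_eq']
    simp +contextual
  rw [h1, Finsupp.sum, Finsupp.sum, Finsupp.sum, Int.cast_sum, ← Finset.sum_sub_distrib]
  refine Finset.sum_congr rfl fun p _ => ?_
  cases p with
  | vertex => simp [Point.onEdge]
  | interior e' s =>
    simp only [Point.onEdge, Point.posOn]
    by_cases h : e' = e
    · subst h
      rcases lt_trichotomy (s : ℝ) t with hlt | heq | hgt
      · have : s ≠ t := fun h => hlt.ne (congrArg _ h)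
        simp [hlt, hlt.le, this]
      · have := Subtype.ext heq
        simp [this]
      · have : s ≠ t := fun h => hgt.ne' (congrArg _ h)
        simp [not_lt.2 hgt.le, not_le.2 hgt, this]
    · simp [h]

end Edge

/-! ### Moving chips on the complete bipartite graph -/

section CompleteBipartite

variable {m n : ℕ}

/-- The chips at a vertex of the first part and inside the edges at that vertex. -/
noncomputable def chipsLeft (D : (completeBipartite m n).Divisor) (i : Fin m) : ℤ :=
  D (.vertex (.inl i)) + ∑ j, edgeDeg D (i, j)

/-- The chips at a vertex of the second part. -/
def chipsRight (D : (completeBipartite m n).Divisor) (j : Fin n) : ℤ :=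
  D (.vertex (.inr j))

/-- The total positions of the chips on the edges. -/
noncomputable def positions (D : (completeBipartite m n).Divisor) (i : Fin m) (j : Fin n) : ℝ :=
  edgePos D (i, j)

lemma deg_eq_sum_chips (D : (completeBipartite m n).Divisor) :
    (completeBipartite m n).deg D = ∑ i, chipsLeft D i + ∑ j, chipsRight D j := by
  rw [deg_eq_sum, Fintype.sum_sum_type, Fintype.sum_prod_type]
  simp only [chipsLeft, chipsRight, Finset.sum_add_distrib]
  ring

/-- If `τ` is an integer, the kink at `Int.fract τ` falls on the initial vertex and lowers the
initial slope by `1`; this is why ceilings appear in `excess`. -/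
lemma ceil_eq_floor_add_one_sub (τ : ℝ) :
    (⌈τ⌉ : ℝ) = ⌊τ⌋ + 1 - if Int.fract τ ≤ 0 then 1 else 0 := by
  split_ifs with h
  · have h0 : Int.fract τ = 0 := le_antisymm h (Int.fract_nonneg τ)
    have h1 : τ = ⌊τ⌋ := by have := Int.floor_add_fract τ; linarith
    have h2 : ⌈τ⌉ = ⌊τ⌋ := by
      conv_lhs => rw [h1]
      exact Int.ceil_intCast _
    rw [h2]
    ring
  · have h2 : ⌈τ⌉ = ⌊τ⌋ + 1 := by
      rw [Int.ceil_eq_iff]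
      push_cast
      have := Int.floor_add_fract τ
      exact ⟨by linarith [not_le.1 h], (Int.lt_floor_add_one τ).le⟩
    rw [h2]
    push_cast
    ring

/-- The potentials `α`, `β` move a divisor to one with at most one chip inside every edge. -/
theorem exists_linEquiv_of_potential (D : (completeBipartite m n).Divisor) (α : Fin m → ℝ)
    (β : Fin n → ℝ) : ∃ D' : (completeBipartite m n).Divisor,
      (completeBipartite m n).LinEquiv D D' ∧
      (∀ i, D' (.vertex (.inl i)) = excess (positions D) (chipsLeft D) α β i - 1) ∧
      (∀ j, D' (.vertex (.inr j)) = excess (negFlip (positions D)) (chipsRight D) β α j - 1) ∧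
      ∀ e t, D' (.interior e t) =
        if (t : ℝ) = Int.fract (positions D e.1 e.2 + α e.1 - β e.2) then 1 else 0 := by
  classical
  set τ : Fin m × Fin n → ℝ := fun e => positions D e.1 e.2 + α e.1 - β e.2 with hτ
  -- The initial slope with which `edgeFun` runs from `-α e.1` to `-β e.2`.
  set k : Fin m × Fin n → ℤ := fun e => 1 - edgeDeg D e + ⌊τ e⌋ with hk
  let g : (completeBipartite m n).Point → ℤ
    | .vertex (.inl i) => excess (positions D) (chipsLeft D) α β i - 1
    | .vertex (.inr j) => excess (negFlip (positions D)) (chipsRight D) β α j - 1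
    | .interior e t => if (t : ℝ) = Int.fract (τ e) then 1 else 0
  let D' : (completeBipartite m n).Divisor := Finsupp.onFinset
    (Finset.univ.image Point.vertex ∪
      Finset.univ.image fun e => (completeBipartite m n).edgePoint e (Int.fract (τ e))) g
    fun p hp => by
      cases p with
      | vertex v => exact Finset.mem_union_left _ (Finset.mem_image_of_mem _ (Finset.mem_univ v))
      | interior e t =>
        have ht : (t : ℝ) = Int.fract (τ e) := by
          by_contra h
          exact hp (if_neg h)
        refine Finset.mem_union_right _ (Finset.mem_image.2 ⟨e, Finset.mem_univ e, ?_⟩)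
        rw [← ht]
        exact edgePoint_of_mem e t.2
  let f : (completeBipartite m n).Point → ℝ
    | .vertex (.inl i) => -α i
    | .vertex (.inr j) => -β j
    | .interior e t => edgeFun D e (-α e.1) (k e) (Int.fract (τ e)) t
  have hf : ∀ e, ∀ t ∈ Set.Icc (0 : ℝ) 1, f ((completeBipartite m n).edgePoint e t) =
      edgeFun D e (-α e.1) (k e) (Int.fract (τ e)) t := by
    intro e t ht
    rcases ht.1.eq_or_lt with rfl | h0
    · rw [edgePoint_zero, edgeFun_zero _ _ _ _ (Int.fract_nonneg _)]
      rfl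
    rcases ht.2.eq_or_lt with rfl | h1
    · rw [show (1 : ℝ) = (completeBipartite m n).len e from rfl, edgePoint_len,
        show (completeBipartite m n).len e = 1 from rfl,
        edgeFun_one D rfl _ _ (Int.fract_lt_one _).le]
      have h2 := Int.floor_add_fract (τ e)
      have h3 : τ e = edgePos D e + α e.1 - β e.2 := rfl
      change -β e.2 = _
      simp only [hk]
      push_cast
      linarith
    · rw [edgePoint_of_mem e (show t ∈ Set.Ioo 0 ((completeBipartite m n).len e) from ⟨h0, h1⟩)]
  have hfwd : ∀ e, ∀ t ∈ Set.Ico (0 : ℝ) 1, (completeBipartite m n).slopeForward f e t =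
      k e + (D.sum fun p z => (z : ℝ) * (p.onEdge e * if p.posOn e ≤ t then 1 else 0)) -
        if Int.fract (τ e) ≤ t then 1 else 0 := by
    intro e t ht
    refine HasDerivWithinAt.derivWithin ?_ (uniqueDiffWithinAt_Ioi t)
    refine (hasDerivWithinAt_edgeFun_Ioi D e (-α e.1) (k e) (Int.fract (τ e))
      t).congr_of_eventuallyEq ?_ (hf e t ⟨ht.1, ht.2.le⟩)
    filter_upwards [Ioo_mem_nhdsGT ht.2] with s hs using hf e s ⟨ht.1.trans hs.1.le, hs.2.le⟩
  have hbwd : ∀ e, ∀ t ∈ Set.Ioc (0 : ℝ) 1, (completeBipartite m n).slopeBackward f e t =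
      -(k e + (D.sum fun p z => (z : ℝ) * (p.onEdge e * if p.posOn e < t then 1 else 0)) -
        if Int.fract (τ e) < t then 1 else 0) := by
    intro e t ht
    refine congrArg Neg.neg (HasDerivWithinAt.derivWithin ?_ (uniqueDiffWithinAt_Iio t))
    refine (hasDerivWithinAt_edgeFun_Iio D e (-α e.1) (k e) (Int.fract (τ e))
      t).congr_of_eventuallyEq ?_ (hf e t ⟨ht.1.le, ht.2⟩)
    filter_upwards [Ioo_mem_nhdsLT ht.1] with s hs using hf e s ⟨hs.1.le, hs.2.le.trans ht.2⟩
  refine ⟨D', ⟨f, fun e => (isIntegerPL_edgeFun D e _ _ _ _).congr (hf e), fun p => ?_⟩,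
    fun i => rfl, fun j => rfl, fun e t => rfl⟩
  cases p with
  | vertex v =>
    cases v with
    | inl i =>
      have hD' : D' (.vertex (.inl i)) = excess (positions D) (chipsLeft D) α β i - 1 := rfl
      have h1 : (completeBipartite m n).ord f (.vertex (.inl i)) =
          ∑ j, (completeBipartite m n).slopeForward f (i, j) 0 := by
        have hsrc : ∀ e, (completeBipartite m n).src e = .inl e.1 := fun _ => rfl
        have htgt : ∀ e, (completeBipartite m n).tgt e ≠ .inl i := fun _ => Sum.inr_ne_inl
        simp only [ord, Finset.sum_filter, hsrc, htgt, Fintype.sum_prod_type_right,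
          Sum.inl.injEq, Finset.sum_ite_eq', Finset.mem_univ, if_true, if_false,
          Finset.sum_const_zero, add_zero]
      have h2 : ∀ j, (completeBipartite m n).slopeForward f (i, j) 0 =
          -edgeDeg D (i, j) + ⌈τ (i, j)⌉ := fun j => by
        rw [hfwd _ 0 ⟨le_rfl, one_pos⟩, sum_onEdge_le_zero, ceil_eq_floor_add_one_sub]
        simp only [hk]
        push_cast
        ring
      rw [h1, hD']
      simp only [h2, excess, chipsLeft]
      push_cast
      rw [Finset.sum_add_distrib, Finset.sum_neg_distrib]
      ring
    | inr j =>
      have hD' : D' (.vertex (.inr j)) =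
        excess (negFlip (positions D)) (chipsRight D) β α j - 1 := rfl
      have h1 : (completeBipartite m n).ord f (.vertex (.inr j)) =
          ∑ i, (completeBipartite m n).slopeBackward f (i, j) 1 := by
        simp [ord, completeBipartite, Finset.sum_filter, Fintype.sum_prod_type]
      have h2 : ∀ i, (completeBipartite m n).slopeBackward f (i, j) 1 =
          ⌈negFlip (positions D) j i + β j - α i⌉ := fun i => by
        rw [hbwd _ 1 ⟨one_pos, le_rfl⟩, sum_onEdge_lt_one D rfl, if_pos (Int.fract_lt_one _),
          show negFlip (positions D) j i + β j - α i = -τ (i, j) by simp only [hτ, negFlip]; ring,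
          Int.ceil_neg]
        simp only [hk]
        push_cast
        ring
      rw [h1, hD']
      simp only [h2, excess, chipsRight]
      push_cast
      ring
  | interior e t =>
    have hD' : D' (.interior e t) = if (t : ℝ) = Int.fract (τ e) then 1 else 0 := rfl
    have ht : (t : ℝ) ∈ Set.Ioo (0 : ℝ) 1 := t.2
    rw [hD', ord, hfwd e t ⟨ht.1.le, ht.2⟩, hbwd e t ⟨ht.1, ht.2.le⟩]
    push_cast
    rw [← sum_onEdge_le_sub_lt]
    rcases lt_trichotomy (Int.fract (τ e)) t with h | h | h
    · rw [if_pos h.le, if_pos h, if_neg h.ne']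
      ring
    · rw [if_pos h.le, if_neg (not_lt.2 h.ge), if_pos h.symm]
      ring
    · rw [if_neg (not_le.2 h), if_neg (not_lt.2 h.le), if_neg h.ne]
      ring

/-! ### Ranks and configurations -/

/-- The set of `k` such that all the divisors `D - F` with `F` effective of degree `k` are
equivalent to effective divisors. -/
def rankSet (D : (completeBipartite m n).Divisor) : Set ℤ :=
  {k : ℤ | -1 ≤ k ∧ ∀ F : (completeBipartite m n).Divisor, 0 ≤ F →
    (completeBipartite m n).deg F = k → ((completeBipartite m n).linearSystem (D - F)).Nonempty}

lemma deg_add (D F : (completeBipartite m n).Divisor) : (completeBipartite m n).deg (D + F) =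
    (completeBipartite m n).deg D + (completeBipartite m n).deg F :=
  Finsupp.sum_add_index' (fun _ => rfl) fun _ _ _ => rfl

lemma deg_single (p : (completeBipartite m n).Point) (z : ℤ) :
    (completeBipartite m n).deg (Finsupp.single p z) = z :=
  Finsupp.sum_single_index rfl

/-- The divisor with the given coefficients at the vertices. -/
noncomputable def vertexDivisor (c : Fin m ⊕ Fin n → ℤ) : (completeBipartite m n).Divisor :=
  Finsupp.embDomain ⟨Point.vertex, fun _ _ h => Point.vertex.inj h⟩
    (Finsupp.equivFunOnFinite.symm c)

lemma vertexDivisor_vertex (c : Fin m ⊕ Fin n → ℤ) (v : Fin m ⊕ Fin n) :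
    vertexDivisor c (.vertex v) = c v :=
  Finsupp.embDomain_apply_self ⟨Point.vertex, fun _ _ h => Point.vertex.inj h⟩ _ v

lemma vertexDivisor_interior (c : Fin m ⊕ Fin n → ℤ) (e t) :
    vertexDivisor c (.interior e t) = 0 :=
  Finsupp.embDomain_of_notMem_range _ _ _ (by simp)

lemma deg_vertexDivisor (c : Fin m ⊕ Fin n → ℤ) :
    (completeBipartite m n).deg (vertexDivisor c) = ∑ v, c v := by
  simp [deg_eq_sum, vertexDivisor_vertex, edgeDeg_eq_zero (vertexDivisor_interior c)]

lemma vertexDivisor_nonneg {c : Fin m ⊕ Fin n → ℤ} (hc : ∀ v, 0 ≤ c v) : 0 ≤ vertexDivisor c := by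
  intro p
  cases p with
  | vertex v => rw [vertexDivisor_vertex]; exact hc v
  | interior e t => rw [vertexDivisor_interior]; exact le_rfl

/-- Putting `F` back changes the ceiling of an edge by at least `0` and at most the number of chips
of `F` inside it. This change is charged to the end in `Fin n` and the remaining chips to the end in
`Fin m`, so each chip of `F` pays once. -/
lemma posExcess_const_le_deg {K : AddSubgroup ℝ} (h1 : (1 : ℝ) ∈ K) {a b : ℤ}
    {F : (completeBipartite m n).Divisor} (hF : 0 ≤ F) {σ : Fin m → Fin n → ℝ}
    (hσF : ∀ i j, σ i j = -edgePos F (i, j)) (hσ : ∀ i j, σ i j ∈ K) {x : Fin m → ℤ}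
    {y : Fin n → ℤ} (hx : ∀ i, x i = b - chipsLeft F i) (hy : ∀ j, y j = a - chipsRight F j)
    {α : Fin m → ℝ} {β : Fin n → ℝ} (h : Generic K α β) (hα : ∀ i, excess σ x α β i ≤ 0)
    (hβ : ∀ j, excess (negFlip σ) y β α j ≤ 0) :
    posExcess (fun _ _ => 0) (fun _ => b) (fun _ => a) α β ≤ (completeBipartite m n).deg F := by
  have h0 : ∀ (i : Fin m) (j : Fin n), (fun _ _ => (0 : ℝ)) i j ∈ K := fun _ _ => K.zero_mem
  have hd : ∀ i j, ⌈0 + α i - β j⌉ - ⌈σ i j + α i - β j⌉ ≤ edgeDeg F (i, j) := fun i j => by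
    have h2 : ⌈0 + α i - β j⌉ ≤ ⌈σ i j + α i - β j + edgeDeg F (i, j)⌉ := Int.ceil_mono (by
      have := edgePos_le hF (e := (i, j)) rfl
      rw [hσF]
      linarith)
    rw [Int.ceil_add_intCast] at h2
    omega
  have hd0 : ∀ i j, 0 ≤ ⌈0 + α i - β j⌉ - ⌈σ i j + α i - β j⌉ := fun i j =>
    sub_nonneg.2 (Int.ceil_mono (by
      have := edgePos_nonneg hF (i, j)
      rw [hσF]
      linarith))
  have hl : ∀ i, max (excess (fun _ _ => 0) (fun _ => b) α β i) 0 ≤ F (.vertex (.inl i)) +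
      ∑ j, (edgeDeg F (i, j) - (⌈0 + α i - β j⌉ - ⌈σ i j + α i - β j⌉)) := fun i => by
    refine max_le ?_ (add_nonneg (hF _) (Finset.sum_nonneg fun j _ => sub_nonneg.2 (hd i j)))
    have := hα i
    simp only [excess, hx, chipsLeft, Finset.sum_sub_distrib] at this ⊢
    omega
  have hr : ∀ j, max (excess (negFlip fun _ _ => 0) (fun _ => a) β α j) 0 ≤ F (.vertex (.inr j)) +
      ∑ i, (⌈0 + α i - β j⌉ - ⌈σ i j + α i - β j⌉) := fun j => by
    refine max_le ?_ (add_nonneg (hF _) (Finset.sum_nonneg fun i _ => hd0 i j))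
    have := hβ j
    simp only [excess, hy, chipsRight, h.ceil_negFlip hσ h1, h.ceil_negFlip h0 h1,
      Finset.sum_sub_distrib] at this ⊢
    omega
  refine (add_le_add (Finset.sum_le_sum fun i _ => hl i)
    (Finset.sum_le_sum fun j _ => hr j)).trans_eq ?_
  rw [deg_eq_sum_chips]
  simp only [chipsLeft, chipsRight, Finset.sum_add_distrib, Finset.sum_sub_distrib]
  rw [Finset.sum_comm (f := fun (j : Fin n) (i : Fin m) => ⌈0 + α i - β j⌉),
    Finset.sum_comm (f := fun (j : Fin n) (i : Fin m) => ⌈σ i j + α i - β j⌉)]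
  ring

variable [NeZero m]

/-- Removing the positive part of `D' + 1` at the vertices costs `posExcess` chips and leaves every
vertex at most `-1`, a class without effective divisors. -/
lemma lt_posExcess_of_mem_rankSet {K : AddSubgroup ℝ} (h1 : (1 : ℝ) ∈ K)
    {D : (completeBipartite m n).Divisor} (hσ : ∀ i j, positions D i j ∈ K) {α : Fin m → ℝ}
    {β : Fin n → ℝ} (h : Generic K α β) {k : ℤ} (hk : k ∈ rankSet D) :
    k < posExcess (positions D) (chipsLeft D) (chipsRight D) α β := by
  classical
  by_contra! hle
  obtain ⟨D', hDD', hl, hr, hint⟩ := exists_linEquiv_of_potential D α β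
  set c : Fin m ⊕ Fin n → ℤ := fun v => max (D' (.vertex v) + 1) 0 with hc
  have hcsum : ∑ v, c v = posExcess (positions D) (chipsLeft D) (chipsRight D) α β := by
    simp [hc, Fintype.sum_sum_type, hl, hr, posExcess]
  set P := posExcess (positions D) (chipsLeft D) (chipsRight D) α β with hP
  -- Extra chips at one vertex bring the degree of `F` up to `k`.
  set e₀ : Fin m ⊕ Fin n → ℤ := fun v => if v = .inl 0 then k - P else 0 with he₀
  set F := vertexDivisor c + vertexDivisor e₀ with hF
  have hs : ∀ v, 0 ≤ e₀ v := fun v => by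
    simp only [he₀]
    split_ifs <;> omega
  have hF0 : 0 ≤ F := add_nonneg (vertexDivisor_nonneg fun v => le_max_right _ _)
    (vertexDivisor_nonneg hs)
  have hFdeg : (completeBipartite m n).deg F = k := by
    rw [hF, deg_add, deg_vertexDivisor, deg_vertexDivisor, hcsum]
    simp [he₀]
  have hne := hDD'.linearSystem_sub_nonempty F (hk.2 F hF0 hFdeg)
  have hfract : ∀ e : Fin m × Fin n, Int.fract (positions D e.1 e.2 + α e.1 - β e.2) ∈
      Set.Ioo 0 ((completeBipartite m n).len e) := fun e => by
    refine ⟨lt_of_le_of_ne (Int.fract_nonneg _) fun h0 => h.flow_notMem hσ e.1 e.2 ?_,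
      Int.fract_lt_one _⟩
    have h2 := Int.floor_add_fract (positions D e.1 e.2 + α e.1 - β e.2)
    rw [← h0, add_zero] at h2
    rw [← h2]
    simpa using zsmul_mem h1 ⌊positions D e.1 e.2 + α e.1 - β e.2⌋
  have hFint : ∀ e t, F (.interior e t) = 0 := fun e t => by
    rw [hF, Finsupp.add_apply, vertexDivisor_interior, vertexDivisor_interior, add_zero]
  refine hne.ne_empty (linearSystem_eq_empty (fun v => ?_) (fun e => ⟨_, hfract e⟩)
    (fun e => ?_) fun e t ht => ?_)
  · have h2 := hs v
    have h3 : D' (.vertex v) + 1 ≤ c v := le_max_left _ _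
    rw [Finsupp.sub_apply, hF, Finsupp.add_apply, vertexDivisor_vertex, vertexDivisor_vertex]
    omega
  · rw [Finsupp.sub_apply, hFint, hint, if_pos rfl, sub_zero]
  · rw [Finsupp.sub_apply, hFint, hint, if_neg fun h => ht (Subtype.ext h), sub_zero]

/-- Needed for the supremum in `rank` to be attained rather than a default value. -/
lemma bddAbove_rankSet (D : (completeBipartite m n).Divisor) : BddAbove (rankSet D) := by
  obtain ⟨K, hc, -, h1, hσ⟩ := exists_countable_dense_addSubgroup (positions D)
  obtain ⟨θ, hθ⟩ := exists_pairwise_sub_notMem (W := Fin m ⊕ Fin n) hc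
  exact ⟨_, fun k hk => (lt_posExcess_of_mem_rankSet h1 hσ (Generic.of_pairwise hθ) hk).le⟩

lemma le_rank_of_mem {D : (completeBipartite m n).Divisor} {k : ℤ} (hk : k ∈ rankSet D) :
    k ≤ (completeBipartite m n).rank D :=
  le_csSup (bddAbove_rankSet D) hk

lemma rank_mem (D : (completeBipartite m n).Divisor) :
    (completeBipartite m n).rank D ∈ rankSet D := by
  refine Int.csSup_mem ⟨-1, le_rfl, fun F hF hdeg => ?_⟩ (bddAbove_rankSet D)
  have : 0 ≤ (completeBipartite m n).deg F := Finset.sum_nonneg fun p _ => hF p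
  omega

/-! ### The two inequalities for the gonality sequence -/

variable [NeZero n]

/-- The degree of a divisor of rank `r` is bounded below by one of the values defining `δ_r`. -/
theorem exists_deltaValue_le_deg {r : ℤ} (h0 : 0 ≤ r) (hr : r < ((m : ℤ) - 1) * (n - 1))
    {D : (completeBipartite m n).Divisor} (hD : r ≤ (completeBipartite m n).rank D) :
    ∃ d ∈ deltaValues m n r, d ≤ (completeBipartite m n).deg D := by
  obtain ⟨K, hc, hK, h1, hσ⟩ := exists_countable_dense_addSubgroup (positions D)
  obtain ⟨θ, hθ⟩ := exists_pairwise_sub_notMem (W := Fin m ⊕ Fin n) hc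
  obtain ⟨α, β, h, hcases⟩ := exists_posExcess_le_rectangle hK h1 hσ (chipsLeft D) (chipsRight D)
    ⟨_, _, Generic.of_pairwise hθ⟩
  have hP := hD.trans_lt (lt_posExcess_of_mem_rankSet h1 hσ h (rank_mem D))
  have hsum := h.sum_excess hσ h1 (chipsLeft D) (chipsRight D)
  rw [← posExcess_sub_negExcess, ← deg_eq_sum_chips, Fintype.card_fin, Fintype.card_fin] at hsum
  simp only [Fintype.card_fin] at hcases
  have hm : 1 ≤ (m : ℤ) := by exact_mod_cast NeZero.one_le
  have hn : 1 ≤ (n : ℤ) := by exact_mod_cast NeZero.one_le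
  rcases hcases with hP0 | hQ0 | ⟨w, l, hw1, hwm, hl1, hln, hPle, hQle⟩
  · omega
  -- Without negative excess the full rectangle is used; `h ≥ 0` follows from `r < (m - 1)(n - 1)`.
  · refine ⟨_, ⟨((m : ℤ) - 1, (n : ℤ) - 1, (m : ℤ) * n - 1 - r),
      ⟨by simpa using hm, le_rfl, by simpa using hn, le_rfl, ?_, ?_⟩, rfl⟩, ?_⟩
    · dsimp only
      nlinarith
    · dsimp only
      ring
    · dsimp only
      linarith
  -- The value of this triple is `r + 1 - (m - w)(n - l) + m n - m - n`, the lower bound for the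
  -- degree given by `hsum`.
  · refine ⟨_, ⟨(w - 1, l - 1, w * l - 1 - r),
      ⟨by simpa using hw1, by simpa using hwm, by simpa using hl1, by simpa using hln, ?_, ?_⟩,
      rfl⟩, ?_⟩
    · dsimp only
      omega
    · dsimp only
      ring
    · dsimp only
      linarith

/-- The divisor with `b` chips at the vertices of the first part and `a` chips at those of the
second part has rank at least `(a + 1) * (b + 1) - 1`. -/
theorem linearSystem_sub_nonempty {a b : ℤ} (ha : 0 ≤ a) (ham : a ≤ m - 1)
    {F : (completeBipartite m n).Divisor} (hF : 0 ≤ F)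
    (hdeg : (completeBipartite m n).deg F < (a + 1) * (b + 1)) :
    ((completeBipartite m n).linearSystem
      (vertexDivisor (Sum.elim (fun _ => b) fun _ => a) - F)).Nonempty := by
  set D := vertexDivisor (Sum.elim (fun (_ : Fin m) => b) fun (_ : Fin n) => a) - F with hD
  obtain ⟨K, hc, hK, h1, hσ⟩ := exists_countable_dense_addSubgroup (positions D)
  rcases exists_effective_or_generic_nonpos hc hK (positions D) (chipsLeft D) (chipsRight D) with
    ⟨α, β, hα, hβ⟩ | ⟨α, β, h, hα, hβ⟩
  · obtain ⟨D', hDD', hl, hr, hint⟩ := exists_linEquiv_of_potential D α β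
    refine ⟨D', fun p => ?_, hDD'⟩
    rw [Finsupp.zero_apply]
    cases p with
    | vertex v =>
      cases v with
      | inl i => rw [hl]; linarith [hα i]
      | inr j => rw [hr]; linarith [hβ j]
    | interior e t => rw [hint]; split_ifs <;> norm_num
  · exfalso
    have hint := vertexDivisor_interior (Sum.elim (fun (_ : Fin m) => b) fun (_ : Fin n) => a)
    have h2 := posExcess_const_le_deg (a := a) (b := b) h1 hF (σ := positions D)
      (fun i j => by
        rw [positions, hD, edgePos_sub, edgePos_eq_zero hint, zero_sub]) hσ (x := chipsLeft D)
      (y := chipsRight D)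
      (fun i => by
        simp only [chipsLeft, hD, Finsupp.sub_apply, vertexDivisor_vertex, edgeDeg_sub,
          edgeDeg_eq_zero hint, Sum.elim_inl, Finset.sum_sub_distrib, Finset.sum_const_zero]
        ring)
      (fun j => by
        simp only [chipsRight, hD, Finsupp.sub_apply, vertexDivisor_vertex, Sum.elim_inr])
      h hα hβ
    have h3 := mul_le_posExcess_const hK h1 (b := b) ha (by rw [Fintype.card_fin]; omega) h
    omega

/-- Taking `h` chips off the constant divisor lowers the rank bound by at most `h`: they are
absorbed into the divisor to be removed. -/
theorem deltaValues_subset_gonalityDegrees {r : ℤ} (h0 : 0 ≤ r) :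
    deltaValues m n r ⊆ (completeBipartite m n).gonalityDegrees r := by
  rintro _ ⟨⟨a, b, h⟩, ⟨ha, ham, -, -, hh, hr⟩, rfl⟩
  dsimp only at ha ham hh hr
  set p : (completeBipartite m n).Point := .vertex (.inl 0)
  set D₀ := vertexDivisor (Sum.elim (fun (_ : Fin m) => b) fun (_ : Fin n) => a) with hD₀
  refine ⟨D₀ + Finsupp.single p (-h), ?_, le_rank_of_mem ⟨by omega, fun F hF hdeg => ?_⟩⟩
  · rw [deg_add, deg_single, deg_vertexDivisor, Fintype.sum_sum_type]
    simp
    ring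
  · have hsub : D₀ + Finsupp.single p (-h) - F = D₀ - (F + Finsupp.single p h) := by
      rw [Finsupp.single_neg]
      abel
    rw [hsub]
    refine linearSystem_sub_nonempty ha ham (add_nonneg hF (Finsupp.single_nonneg.2 hh)) ?_
    rw [deg_add, deg_single, hdeg]
    omega

end CompleteBipartite

end MetricGraph

/-! ### The gonality sequence -/

lemma bddBelow_deltaValues (m n : ℕ) (r : ℤ) : BddBelow (deltaValues m n r) := by
  refine ⟨-((m : ℤ) * n) + r + 1, ?_⟩
  rintro _ ⟨⟨a, b, h⟩, ⟨ha, ham, hb, hbn, hh, hr⟩, rfl⟩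
  dsimp only at *
  nlinarith

lemma deltaValues_nonempty {m n : ℕ} (hm : 0 < m) (hn : 0 < n) {r : ℤ}
    (hr : r < ((m : ℤ) - 1) * (n - 1)) : (deltaValues m n r).Nonempty := by
  have hm' : 1 ≤ (m : ℤ) := by exact_mod_cast hm
  have hn' : 1 ≤ (n : ℤ) := by exact_mod_cast hn
  refine ⟨_, ((m : ℤ) - 1, (n : ℤ) - 1, (m : ℤ) * n - 1 - r),
    ⟨by simpa using hm', le_rfl, by simpa using hn', le_rfl, ?_, ?_⟩, rfl⟩
  · dsimp only
    nlinarith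
  · dsimp only
    ring

theorem theorem1p3 (m n : ℕ) (hm : 0 < m) (hn : 0 < n) :
    (MetricGraph.completeBipartite m n).genus = ((m : ℤ) - 1) * ((n : ℤ) - 1) ∧
    ∀ r : ℤ, 0 < r → r < ((m : ℤ) - 1) * ((n : ℤ) - 1) →
      IsLeast ((MetricGraph.completeBipartite m n).gonalityDegrees r)
        ((MetricGraph.completeBipartite m n).gonality r) ∧
      IsLeast (deltaValues m n r) (delta m n r) ∧
      (MetricGraph.completeBipartite m n).gonality r = delta m n r := by
  have : NeZero m := ⟨hm.ne'⟩
  have : NeZero n := ⟨hn.ne'⟩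
  refine ⟨?_, fun r h0 hr => ?_⟩
  · simp [MetricGraph.genus]
    ring
  have hdelta : IsLeast (deltaValues m n r) (delta m n r) :=
    ⟨Int.csInf_mem (deltaValues_nonempty hm hn hr) (bddBelow_deltaValues m n r),
      fun d hd => csInf_le (bddBelow_deltaValues m n r) hd⟩
  have hgon : IsLeast ((MetricGraph.completeBipartite m n).gonalityDegrees r) (delta m n r) := by
    refine ⟨MetricGraph.deltaValues_subset_gonalityDegrees h0.le hdelta.1, ?_⟩
    rintro _ ⟨D, rfl, hD⟩
    obtain ⟨d, hd, hle⟩ := MetricGraph.exists_deltaValue_le_deg h0.le hr hD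
    exact (hdelta.2 hd).trans hle
  have heq : (MetricGraph.completeBipartite m n).gonality r = delta m n r := hgon.csInf_eq
  exact ⟨heq ▸ hgon, hdelta, heq⟩
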